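/- Let $n\ge 1$ and let $\Phi:\mathbb R^n\to\mathbb R$ be a $\mathcal C^1$, strictly convex and even function with $\Phi\ge 0$, $\Phi(0)=0$ and $\lim_{|x|\to\infty}\Phi(x)/|x|=\infty$. Let $\Phi^*(x)=\sup_{z\in\mathbb R^n}\{x\cdot z-\Phi(z)\}$ be its Fenchel--Legendre transform, and let $\mu_\Phi$ be the probability measure $d\mu_\Phi(x)=e^{-\Phi(x)}dx/Z_\Phi$, where $Z_\Phi=\int_{\mathbb R^n} e^{-\Phi(x)}dx$. For a positive function $f$ put $\mathrm{Ent}_{\mu_\Phi}(f)=\int f\log\frac{f}{\int f\,d\mu_\Phi}\,d\mu_\Phi$. Assume that $$\lim_{\alpha\to 0,\ \alpha\in[0,1]}\ \sup_{x\in\mathbb R^n,\ x\neq 0}\left\{(1-\alpha)\frac{\Phi^*\left(\frac{x}{1-\alpha}\right)}{\Phi^*(x)}\right\}=1,$$ and that there exists $A>0$ such that $$x\cdot\nabla\Phi(x)\le (A+1)\Phi(x)\qquad\text{for all }x\in\mathbb R^n.$$ Then there exist constants $C_1,C_2\ge 0$ such that for every $\mathcal C^1$ function $g:\mathbb R^n\to\mathbb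 R$ for which $e^g$ and $g e^g$ are $\mu_\Phi$-integrable, $\int e^g\,d\mu_\Phi=1$ and $\mathrm{Ent}_{\mu_\Phi}(e^g)\ge 1$, one has $$\mathrm{Ent}_{\mu_\Phi}(e^g)\le C_1\int \Phi^*(C_2\nabla g)\,e^g\,d\mu_\Phi,$$ where the integral on the right, whose integrand is nonnegative, takes its value in $[0,\infty]$. -/

import Mathlib

open MeasureTheory Filter Topology

noncomputable section

/-- Fenchel-Legendre transform `Φ*(x) = sup_z (x · z - Φ z)`. The supremum is taken in `ℝ`; it is a
genuine (finite) supremum as soon as `Φ` is continuous and superlinear. -/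
def legendre {n : ℕ} (Φ : EuclideanSpace ℝ (Fin n) → ℝ) (x : EuclideanSpace ℝ (Fin n)) : ℝ :=
  ⨆ z : EuclideanSpace ℝ (Fin n), (inner ℝ x z - Φ z)

/-- The normalisation constant `Z_Φ = ∫ e^{-Φ(x)} dx`. -/
def partitionFn {n : ℕ} (Φ : EuclideanSpace ℝ (Fin n) → ℝ) : ℝ :=
  ∫ x, Real.exp (-Φ x)

/-- The measure `dμ_Φ(x) = Z_Φ⁻¹ e^{-Φ(x)} dx`. -/
def gibbs {n : ℕ} (Φ : EuclideanSpace ℝ (Fin n) → ℝ) : Measure (EuclideanSpace ℝ (Fin n)) :=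
  volume.withDensity (fun x => ENNReal.ofReal (Real.exp (-Φ x) / partitionFn Φ))

/-- The entropy `Ent_μ(f) = ∫ f log (f / ∫ f dμ) dμ`. -/
def ent {n : ℕ} (μ : Measure (EuclideanSpace ℝ (Fin n)))
    (f : EuclideanSpace ℝ (Fin n) → ℝ) : ℝ :=
  ∫ x, f x * Real.log (f x / ∫ y, f y ∂μ) ∂μ

/-- `ψ(α) = sup_x (1 - α) Φ*(x / (1 - α)) / Φ*(x)`, with values in the extended reals. The point
`x = 0`, where the quotient reads `0 / 0`, is left out. -/
def legendreRatio {n : ℕ} (Φ : EuclideanSpace ℝ (Fin n) → ℝ) (α : ℝ) : EReal :=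
  ⨆ (x : EuclideanSpace ℝ (Fin n)) (_ : x ≠ 0),
    (((1 - α) * legendre Φ ((1 - α)⁻¹ • x) / legendre Φ x : ℝ) : EReal)

end

noncomputable section

open scoped ENNReal Pointwise

/-! The proof derives a modified logarithmic Sobolev inequality from Prékopa-Leindler and then
absorbs its error term. Applying Prékopa-Leindler with weights `1 - s` and `s` to `exp (g / (1 -
s))` and the constant `1`, relative to the Gibbs measure, bounds `(∫ e^{g/(1-s)})^{1-s}` by `∫ e^{g
+ s k_s}`, where `k_s` dominates a difference quotient coming from the sup-convolution of `g`.
Comparing first-order terms as `s → 0` gives `∫ g e^g ≤ ∫ W e^g`, where `W` must dominate `p·z + Φ z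
- ∇Φ(z)·z + Φ*(∇Φ(z) - p)` with `p` near `∇g(z)`.

`exists_le_mul_add_legendre` bounds that expression by `δ Φ(z) + 2 Φ*(C p)` for arbitrarily small
`δ`. Convexity separates `∇Φ(z)` from `p`, and the ratio assumption makes this cost only a factor `1
+ κ` on `Φ*(∇Φ(z))`. The equality case of Fenchel-Young cancels the main terms, and the growth
condition gives `Φ*(∇Φ) ≤ A Φ` for the excess.

The resulting inequality is proved for bounded `g` with bounded gradient
(`integral_mul_exp_le_of_bounded`), then extended by spatial cutoff and by truncation of values
(`integral_mul_exp_le`). Finally `mul_exp_le_entropy` bounds `∫ Φ e^g` by the entropy plus a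
constant. An entropy of at least `1` swallows the constant, and small `δ` makes the error at most
half the entropy. -/

/-! ### Brunn-Minkowski and Prékopa-Leindler on the line -/

/-- The translates of `A` by `min B` and of `B` by `max A` both lie in `S` and meet only at `max A +
min B`. -/
theorem volume_add_volume_le_of_isCompact {A B S : Set ℝ} (hA : IsCompact A) (hB : IsCompact B)
    (hA0 : A.Nonempty) (hB0 : B.Nonempty) (hS : ∀ a ∈ A, ∀ b ∈ B, a + b ∈ S) :
    volume A + volume B ≤ volume S := by
  obtain ⟨a, ha, ha'⟩ := hA.exists_isGreatest hA0
  obtain ⟨b, hb, hb'⟩ := hB.exists_isLeast hB0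
  have h1 : volume ((fun x => b + x) '' A) = volume A := by
    rw [Set.image_add_left, measure_preimage_add]
  have h2 : volume ((fun x => a + x) '' B) = volume B := by
    rw [Set.image_add_left, measure_preimage_add]
  rw [← h1, ← h2, ← measure_union₀]
  · refine measure_mono ?_
    rintro _ (⟨x, hx, rfl⟩ | ⟨x, hx, rfl⟩)
    · simpa only [add_comm] using hS x hx b hb
    · exact hS a ha x hx
  · exact (hB.image (by fun_prop)).measurableSet.nullMeasurableSet
  · refine measure_mono_null (t := {a + b}) ?_ (by simp)
    rintro _ ⟨⟨x, hx, rfl⟩, ⟨y, hy, hxy⟩⟩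
    have := ha' hx
    have := hb' hy
    simp only [Set.mem_singleton_iff] at *
    linarith

theorem volume_add_volume_le {A B S : Set ℝ} (hA : MeasurableSet A) (hB : MeasurableSet B)
    (hA0 : A.Nonempty) (hB0 : B.Nonempty) (hS : ∀ a ∈ A, ∀ b ∈ B, a + b ∈ S) :
    volume A + volume B ≤ volume S := by
  have key : ∀ K ⊆ A, IsCompact K → ∀ L ⊆ B, IsCompact L → volume K + volume L ≤ volume S := by
    intro K hK hKc L hL hLc
    obtain ⟨a, ha⟩ := hA0
    obtain ⟨b, hb⟩ := hB0
    -- A compact subset may be empty, so a point of the ambient set is added to it.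
    refine le_trans (add_le_add (measure_mono (Set.subset_insert a K))
      (measure_mono (Set.subset_insert b L)))
      (volume_add_volume_le_of_isCompact (hKc.insert a) (hLc.insert b) (Set.insert_nonempty _ _)
        (Set.insert_nonempty _ _) ?_)
    exact fun x hx y hy => hS x (Set.insert_subset ha hK hx) y (Set.insert_subset hb hL hy)
  rw [hA.measure_eq_iSup_isCompact, hB.measure_eq_iSup_isCompact]
  refine ENNReal.biSup_add_biSup_le' ?_ ?_ ?_
  · exact ⟨∅, Set.empty_subset _⟩
  · exact ⟨∅, Set.empty_subset _⟩
  · intro K hK L hL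
    by_cases hKc : IsCompact K <;> by_cases hLc : IsCompact L
    · simpa [hKc, hLc] using key K hK hKc L hL hLc
    · simpa [hKc, hLc] using key K hK hKc ∅ (Set.empty_subset _) isCompact_empty
    · simpa [hKc, hLc] using key ∅ (Set.empty_subset _) isCompact_empty L hL hLc
    · simp [hKc, hLc]

/-- The one-dimensional Brunn-Minkowski inequality for convex combinations. -/
theorem brunnMinkowski_real {A B S : Set ℝ} {t s : ℝ} (ht : 0 < t) (hs : 0 < s)
    (hA : MeasurableSet A) (hB : MeasurableSet B)
    (hA0 : A.Nonempty) (hB0 : B.Nonempty) (hS : ∀ a ∈ A, ∀ b ∈ B, t * a + s * b ∈ S) :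
    ENNReal.ofReal t * volume A + ENNReal.ofReal s * volume B ≤ volume S := by
  have e : ∀ {r : ℝ} (_ : 0 < r) (X : Set ℝ), ENNReal.ofReal r * volume X = volume (r • X) := by
    intro r hr X
    rw [Measure.addHaar_smul]; simp [abs_of_pos hr]
  rw [e ht, e hs]
  refine volume_add_volume_le (hA.const_smul₀ t) (hB.const_smul₀ s) hA0.smul_set hB0.smul_set ?_
  rintro _ ⟨a, ha, rfl⟩ _ ⟨b, hb, rfl⟩
  exact hS a ha b hb

/-- Superlevel sets at a height `r < 1` are nonempty, so Brunn-Minkowski applies to them; those at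
`r ≥ 1` are empty for `f` and `g`. The layer-cake formula integrates this over `r`. -/
theorem prekopaLeindler_real_normalized {f g h : ℝ → ℝ} {t s : ℝ} (ht : 0 < t) (hs : 0 < s)
    (hts : t + s = 1) (hf : Measurable f) (hg : Measurable g) (hh : Measurable h)
    (hf0 : ∀ x, 0 ≤ f x) (hg0 : ∀ x, 0 ≤ g x) (hh0 : ∀ x, 0 ≤ h x)
    (hf1 : ∀ x, f x ≤ 1) (hg1 : ∀ x, g x ≤ 1)
    (hf2 : ∀ r < 1, ∃ x, r < f x) (hg2 : ∀ r < 1, ∃ x, r < g x)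
    (H : ∀ x y, f x ^ t * g y ^ s ≤ h (t * x + s * y)) :
    ENNReal.ofReal t * (∫⁻ x, ENNReal.ofReal (f x))
        + ENNReal.ofReal s * (∫⁻ x, ENNReal.ofReal (g x))
      ≤ ∫⁻ x, ENNReal.ofReal (h x) := by
  rw [lintegral_eq_lintegral_meas_lt _ (.of_forall hf0) hf.aemeasurable,
    lintegral_eq_lintegral_meas_lt _ (.of_forall hg0) hg.aemeasurable,
    lintegral_eq_lintegral_meas_lt _ (.of_forall hh0) hh.aemeasurable]
  have anti : ∀ k : ℝ → ℝ, Measurable fun r => volume {x | r < k x} := fun k =>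
    Antitone.measurable fun r r' hr => measure_mono fun x (hx : r' < k x) => lt_of_le_of_lt hr hx
  rw [← lintegral_const_mul _ (anti f), ← lintegral_const_mul _ (anti g),
    ← lintegral_add_left ((anti f).const_mul _)]
  refine setLIntegral_mono (anti h) fun r hr => ?_
  rcases lt_or_ge r 1 with h1 | h1
  · refine brunnMinkowski_real ht hs (measurableSet_lt measurable_const hf)
      (measurableSet_lt measurable_const hg) (hf2 r h1) (hg2 r h1) fun a ha b hb => ?_
    have hr : 0 < r := hr
    simp only [Set.mem_ofPred_eq] at ha hb ⊢
    refine lt_of_lt_of_le ?_ (H a b)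
    calc r = r ^ t * r ^ s := by rw [← Real.rpow_add hr, hts, Real.rpow_one]
      _ < f a ^ t * g b ^ s := by
        refine mul_lt_mul'' (Real.rpow_lt_rpow hr.le ha ht) (Real.rpow_lt_rpow hr.le hb hs) ?_ ?_ <;>
          positivity
  · have e1 : {x | r < f x} = ∅ := by
      ext x; simpa using (hf1 x).trans h1
    have e2 : {x | r < g x} = ∅ := by
      ext x; simpa using (hg1 x).trans h1
    simp [e1, e2]

theorem ENNReal.rpow_mul_rpow_le_add {t s : ℝ} (ht : 0 < t) (hs : 0 < s) (hts : t + s = 1)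
    (a b : ℝ≥0∞) : a ^ t * b ^ s ≤ ENNReal.ofReal t * a + ENNReal.ofReal s * b := by
  have hc : (1 / t).HolderConjugate (1 / s) := by
    rw [Real.holderConjugate_iff]
    constructor
    · rw [one_lt_div ht]; linarith
    · simpa using hts
  have := ENNReal.young_inequality (a ^ t) (b ^ s) hc
  rw [← ENNReal.rpow_mul, ← ENNReal.rpow_mul, mul_one_div_cancel ht.ne', mul_one_div_cancel hs.ne',
    ENNReal.rpow_one, ENNReal.rpow_one, one_div, one_div, ENNReal.ofReal_inv_of_pos ht,
    ENNReal.ofReal_inv_of_pos hs, ENNReal.div_eq_inv_mul, ENNReal.div_eq_inv_mul, inv_inv,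
    inv_inv] at this
  exact this

/-- Dividing by the suprema reduces to the normalized case, whose arithmetic mean dominates the
geometric mean. -/
theorem prekopaLeindler_real_of_bounded {f g h : ℝ → ℝ≥0∞} {t s : ℝ} (ht : 0 < t) (hs : 0 < s)
    (hts : t + s = 1) (hf : Measurable f) (hg : Measurable g) (hh : Measurable h)
    (hfb : ⨆ x, f x ≠ ∞) (hgb : ⨆ x, g x ≠ ∞)
    (H : ∀ x y, f x ^ t * g y ^ s ≤ h (t * x + s * y)) :
    (∫⁻ x, f x) ^ t * (∫⁻ x, g x) ^ s ≤ ∫⁻ x, h x := by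
  set a := ⨆ x, f x with ha
  set b := ⨆ x, g x with hb
  have hfa : ∀ x, f x ≤ a := le_iSup f
  have hgb' : ∀ x, g x ≤ b := le_iSup g
  rcases eq_or_ne a 0 with ha0 | ha0
  · have : ∀ x, f x = 0 := fun x => le_antisymm (ha0 ▸ hfa x) zero_le
    simp [this, ht]
  rcases eq_or_ne b 0 with hb0 | hb0
  · have : ∀ x, g x = 0 := fun x => le_antisymm (hb0 ▸ hgb' x) zero_le
    simp [this, hs]
  have key : ∀ (k : ℝ → ℝ≥0∞) (c : ℝ≥0∞), c = ⨆ x, k x → c ≠ 0 → c ≠ ∞ →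
      (∀ x, k x / c ≤ 1) ∧ (∀ r < (1 : ℝ), ∃ x, r < (k x / c).toReal) := by
    intro k c hc hc0 hct
    have h1 : ∀ x, k x / c ≤ 1 := fun x => by
      rw [ENNReal.div_le_iff hc0 hct, one_mul, hc]; exact le_iSup k x
    refine ⟨h1, fun r hr => ?_⟩
    by_contra! hcon
    rcases lt_or_ge r 0 with hr0 | hr0
    · exact absurd (hcon 0) (not_le.2 (hr0.trans_le ENNReal.toReal_nonneg))
    have : c ≤ ENNReal.ofReal r * c := by
      conv_lhs => rw [hc]
      refine iSup_le fun x => ?_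
      rw [← ENNReal.div_le_iff hc0 hct]
      exact (ENNReal.le_ofReal_iff_toReal_le (ne_top_of_le_ne_top ENNReal.one_ne_top (h1 x)) hr0).2
        (hcon x)
    have h2 : ENNReal.ofReal r * c < 1 * c :=
      ENNReal.mul_lt_mul_left hc0 hct (ENNReal.ofReal_lt_one.2 hr)
    rw [one_mul] at h2
    exact absurd this (not_le.2 h2)
  obtain ⟨hf1, hf2⟩ := key f a ha ha0 hfb
  obtain ⟨hg1, hg2⟩ := key g b hb hb0 hgb
  set d := a ^ t * b ^ s with hd
  have hd0 : d ≠ 0 := by simp [hd, ha0, hb0, hfb, hgb]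
  have hdt : d ≠ ∞ := ENNReal.mul_ne_top (ENNReal.rpow_ne_top_of_nonneg ht.le hfb)
    (ENNReal.rpow_ne_top_of_nonneg hs.le hgb)
  -- Capping `h / d` at `1` keeps it finite and costs nothing, since the normalized product is at
  -- most `1`.
  have main := prekopaLeindler_real_normalized (f := fun x => (f x / a).toReal)
    (g := fun x => (g x / b).toReal) (h := fun x => (min (h x / d) 1).toReal) ht hs hts
    (hf.div_const a).ennreal_toReal (hg.div_const b).ennreal_toReal
    ((hh.div_const d).min measurable_const).ennreal_toReal
    (fun _ => ENNReal.toReal_nonneg) (fun _ => ENNReal.toReal_nonneg)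
    (fun _ => ENNReal.toReal_nonneg)
    (fun x => ENNReal.toReal_le_of_le_ofReal zero_le_one (by simpa using hf1 x))
    (fun x => ENNReal.toReal_le_of_le_ofReal zero_le_one (by simpa using hg1 x)) hf2 hg2
    (by
      intro x y
      rw [ENNReal.toReal_rpow, ENNReal.toReal_rpow, ← ENNReal.toReal_mul]
      refine ENNReal.toReal_mono (ne_top_of_le_ne_top ENNReal.one_ne_top (min_le_right _ _)) ?_
      refine le_min ?_ ?_
      · rw [ENNReal.div_rpow_of_nonneg _ _ ht.le, ENNReal.div_rpow_of_nonneg _ _ hs.le,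
          ENNReal.le_div_iff_mul_le (.inl hd0) (.inl hdt)]
        refine le_trans (le_of_eq ?_) (H x y)
        have e1 : f x ^ t / a ^ t * a ^ t = f x ^ t :=
          ENNReal.div_mul_cancel (by simp [ha0, hfb]) (ENNReal.rpow_ne_top_of_nonneg ht.le hfb)
        have e2 : g y ^ s / b ^ s * b ^ s = g y ^ s :=
          ENNReal.div_mul_cancel (by simp [hb0, hgb]) (ENNReal.rpow_ne_top_of_nonneg hs.le hgb)
        rw [hd, mul_mul_mul_comm, e1, e2]
      · exact mul_le_one' (ENNReal.rpow_le_one (hf1 x) ht.le) (ENNReal.rpow_le_one (hg1 y) hs.le))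
  have e1 : ∀ x, ENNReal.ofReal (f x / a).toReal = f x / a := fun x =>
    ENNReal.ofReal_toReal (ne_top_of_le_ne_top ENNReal.one_ne_top (hf1 x))
  have e2 : ∀ x, ENNReal.ofReal (g x / b).toReal = g x / b := fun x =>
    ENNReal.ofReal_toReal (ne_top_of_le_ne_top ENNReal.one_ne_top (hg1 x))
  have e3 : ∀ x, ENNReal.ofReal (min (h x / d) 1).toReal ≤ h x / d := fun x =>
    ENNReal.ofReal_toReal_le.trans (min_le_left _ _)
  simp only [e1, e2] at main
  have h3 := main.trans (lintegral_mono e3)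
  simp only [div_eq_mul_inv] at h3
  rw [lintegral_mul_const _ hf, lintegral_mul_const _ hg, lintegral_mul_const _ hh] at h3
  have h4 := (ENNReal.rpow_mul_rpow_le_add ht hs hts _ _).trans h3
  rw [ENNReal.mul_rpow_of_nonneg _ _ ht.le, ENNReal.mul_rpow_of_nonneg _ _ hs.le,
    ENNReal.inv_rpow, ENNReal.inv_rpow, mul_mul_mul_comm,
    ← ENNReal.mul_inv (.inl (by simp [ha0, hfb])) (.inl (ENNReal.rpow_ne_top_of_nonneg ht.le hfb)),
    ← hd, ENNReal.mul_le_mul_iff_left (by simpa using hdt) (by simpa using hd0)] at h4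
  exact h4

theorem ENNReal.lintegral_eq_iSup_lintegral_min_nat {α : Type*} [MeasurableSpace α] (μ : Measure α)
    {f : α → ℝ≥0∞} (hf : Measurable f) :
    ∫⁻ x, f x ∂μ = ⨆ N : ℕ, ∫⁻ x, min (f x) N ∂μ := by
  rw [← lintegral_iSup (fun N => hf.min measurable_const)
    fun N M hNM x => min_le_min le_rfl (by exact_mod_cast hNM)]
  congr with x
  have : (⨆ N : ℕ, (N : ℝ≥0∞)) = ∞ := ENNReal.iSup_natCast
  have h := inf_iSup_eq (f x) fun N : ℕ => (N : ℝ≥0∞)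
  rw [this, inf_top_eq] at h
  exact h

theorem prekopaLeindler_real {f g h : ℝ → ℝ≥0∞} {t s : ℝ} (ht : 0 < t) (hs : 0 < s)
    (hts : t + s = 1) (hf : Measurable f) (hg : Measurable g) (hh : Measurable h)
    (H : ∀ x y, f x ^ t * g y ^ s ≤ h (t * x + s * y)) :
    (∫⁻ x, f x) ^ t * (∫⁻ x, g x) ^ s ≤ ∫⁻ x, h x := by
  have key : ∀ N : ℕ, (∫⁻ x, min (f x) N) ^ t * (∫⁻ x, min (g x) N) ^ s ≤ ∫⁻ x, h x := fun N =>
    prekopaLeindler_real_of_bounded ht hs hts (hf.min measurable_const) (hg.min measurable_const) hh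
      (ne_top_of_le_ne_top (ENNReal.natCast_ne_top N) (iSup_le fun x => min_le_right _ _))
      (ne_top_of_le_ne_top (ENNReal.natCast_ne_top N) (iSup_le fun x => min_le_right _ _))
      fun x y => le_trans (mul_le_mul' (ENNReal.rpow_le_rpow (min_le_left _ _) ht.le)
        (ENNReal.rpow_le_rpow (min_le_left _ _) hs.le)) (H x y)
  have mono : ∀ {k : ℝ → ℝ≥0∞}, Monotone fun N : ℕ => ∫⁻ x, min (k x) N := fun {k} N M hNM =>
    lintegral_mono fun x => min_le_min le_rfl (by exact_mod_cast hNM)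
  have e : ∀ {r : ℝ} (_ : 0 < r) (u : ℕ → ℝ≥0∞), (⨆ N, u N) ^ r = ⨆ N, u N ^ r := fun hr u =>
    (ENNReal.orderIsoRpow _ hr).map_iSup u
  rw [ENNReal.lintegral_eq_iSup_lintegral_min_nat _ hf,
    ENNReal.lintegral_eq_iSup_lintegral_min_nat _ hg, e ht, e hs]
  simp only [ENNReal.iSup_mul, ENNReal.mul_iSup, iSup_le_iff]
  refine fun N M => le_trans (mul_le_mul' ?_ ?_) (key (max N M))
  · exact ENNReal.rpow_le_rpow (mono (le_max_right _ _)) ht.le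
  · exact ENNReal.rpow_le_rpow (mono (le_max_left _ _)) hs.le

/-! ### Prékopa-Leindler in higher dimension -/

theorem lintegral_fin_succ {n : ℕ} {f : (Fin (n + 1) → ℝ) → ℝ≥0∞} (hf : Measurable f) :
    ∫⁻ x, f x = ∫⁻ a : ℝ, ∫⁻ w : Fin n → ℝ, f (Fin.cons a w) := by
  let e := (MeasurableEquiv.piFinSuccAbove (fun _ : Fin (n + 1) => ℝ) 0).symm
  have mp : MeasurePreserving e :=
    (volume_preserving_piFinSuccAbove (fun _ : Fin (n + 1) => ℝ) 0).symm
  rw [← mp.lintegral_comp hf, Measure.volume_eq_prod,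
    lintegral_prod (fun a => f (e a)) (hf.comp mp.measurable).aemeasurable]
  simp [e, MeasurableEquiv.piFinSuccAbove, Fin.consEquiv]

/-- The Prékopa-Leindler inequality on `ℝⁿ`. -/
theorem prekopaLeindler_pi {n : ℕ} {f g h : (Fin n → ℝ) → ℝ≥0∞} {t s : ℝ} (ht : 0 < t) (hs : 0 < s)
    (hts : t + s = 1) (hf : Measurable f) (hg : Measurable g) (hh : Measurable h)
    (H : ∀ x y, f x ^ t * g y ^ s ≤ h (t • x + s • y)) :
    (∫⁻ x, f x) ^ t * (∫⁻ x, g x) ^ s ≤ ∫⁻ x, h x := by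
  induction n with
  | zero =>
    rw [volume_pi, Measure.pi_of_empty (fun _ : Fin 0 => (volume : Measure ℝ)) 0]
    simp only [lintegral_dirac]
    convert H 0 0
  | succ n ih =>
    have mc : Measurable fun p : ℝ × (Fin n → ℝ) => (Fin.cons p.1 p.2 : Fin (n + 1) → ℝ) := by
      convert (MeasurableEquiv.piFinSuccAbove (fun _ : Fin (n + 1) => ℝ) 0).symm.measurable using 1
      ext p : 1
      simp [MeasurableEquiv.piFinSuccAbove, Fin.consEquiv]
    have mc' : ∀ a : ℝ, Measurable fun w : Fin n → ℝ => (Fin.cons a w : Fin (n + 1) → ℝ) :=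
      fun a => mc.comp measurable_prodMk_left
    rw [lintegral_fin_succ hf, lintegral_fin_succ hg, lintegral_fin_succ hh]
    -- The line case is applied to the slice integrals; its hypothesis is the inductive statement on
    -- slices.
    refine prekopaLeindler_real ht hs hts (hf.comp mc).lintegral_prod_right'
      (hg.comp mc).lintegral_prod_right' (hh.comp mc).lintegral_prod_right' fun x y => ?_
    refine ih (hf.comp (mc' x)) (hg.comp (mc' y)) (hh.comp (mc' _)) fun u v => ?_
    convert H (Fin.cons x u) (Fin.cons y v) using 2
    ext i
    refine Fin.cases ?_ (fun j => ?_) i <;> simp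

/-- The Prékopa-Leindler inequality on Euclidean space. -/
theorem prekopaLeindler_euclidean {n : ℕ} {f g h : EuclideanSpace ℝ (Fin n) → ℝ≥0∞} {t s : ℝ}
    (ht : 0 < t) (hs : 0 < s) (hts : t + s = 1)
    (hf : Measurable f) (hg : Measurable g) (hh : Measurable h)
    (H : ∀ x y, f x ^ t * g y ^ s ≤ h (t • x + s • y)) :
    (∫⁻ x, f x) ^ t * (∫⁻ x, g x) ^ s ≤ ∫⁻ x, h x := by
  have mp := PiLp.volume_preserving_toLp (Fin n)
  rw [← mp.lintegral_comp hf, ← mp.lintegral_comp hg, ← mp.lintegral_comp hh]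
  exact prekopaLeindler_pi ht hs hts (hf.comp mp.measurable) (hg.comp mp.measurable)
    (hh.comp mp.measurable) fun x y => H _ _

/-! ### The potential, its Legendre transform and the key pointwise inequality -/

variable {n : ℕ}

/-- The standing assumptions on the potential `Φ`. -/
structure IsPotential (Φ : EuclideanSpace ℝ (Fin n) → ℝ) : Prop where
  smooth : ContDiff ℝ 1 Φ
  convex : ConvexOn ℝ Set.univ Φ
  even : ∀ x, Φ (-x) = Φ x
  superlinear : Tendsto (fun x => Φ x / ‖x‖) (cocompact (EuclideanSpace ℝ (Fin n))) atTop
  nonneg : ∀ x, 0 ≤ Φ x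
  zero : Φ 0 = 0

theorem ConvexOn.add_inner_gradient_le {Φ : EuclideanSpace ℝ (Fin n) → ℝ}
    (hc : ConvexOn ℝ Set.univ Φ) (hd : Differentiable ℝ Φ) (z y : EuclideanSpace ℝ (Fin n)) :
    Φ z + inner ℝ (gradient Φ z) (y - z) ≤ Φ y := by
  have h1 : ConvexOn ℝ Set.univ (Φ ∘ AffineMap.lineMap (k := ℝ) z y) := by
    simpa using hc.comp_affineMap (AffineMap.lineMap z y)
  have h2 : HasDerivAt (Φ ∘ AffineMap.lineMap (k := ℝ) z y) (inner ℝ (gradient Φ z) (y - z)) 0 := by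
    rw [inner_gradient_left]
    refine HasFDerivAt.comp_hasDerivAt (0 : ℝ) ?_ AffineMap.hasDerivAt_lineMap
    simpa using (hd z).hasFDerivAt
  have h3 := h1.le_slope_of_hasDerivWithinAt (Set.mem_univ 0) (Set.mem_univ 1) one_pos
    h2.hasDerivWithinAt
  simp only [slope_def_field, Function.comp_apply, AffineMap.lineMap_apply_zero,
    AffineMap.lineMap_apply_one, sub_zero, div_one] at h3
  linarith

namespace IsPotential

variable {Φ : EuclideanSpace ℝ (Fin n) → ℝ} (hΦ : IsPotential Φ)
include hΦ

theorem differentiable : Differentiable ℝ Φ := hΦ.smooth.differentiable (by simp)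

theorem continuous : Continuous Φ := hΦ.smooth.continuous

theorem exists_mul_norm_le (K : ℝ) (hK : 0 ≤ K) : ∃ c, 0 ≤ c ∧ ∀ z, K * ‖z‖ ≤ Φ z + c := by
  have h := hΦ.superlinear.eventually (eventually_ge_atTop K)
  rw [← Metric.cobounded_eq_cocompact, ← comap_norm_atTop, eventually_comap] at h
  obtain ⟨R, hR⟩ := (h.and (eventually_gt_atTop 0)).exists_forall_of_atTop
  have hR0 : 0 < R := (hR R le_rfl).2
  refine ⟨K * R, by positivity, fun z => ?_⟩
  rcases le_total R ‖z‖ with hz | hz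
  · have h1 := (hR ‖z‖ hz).1 z rfl
    rw [le_div_iff₀ (hR0.trans_le hz)] at h1
    have : 0 ≤ K * R := by positivity
    linarith
  · have := mul_le_mul_of_nonneg_left hz hK
    linarith [hΦ.nonneg z]

theorem bddAbove_legendre (x : EuclideanSpace ℝ (Fin n)) :
    BddAbove (Set.range fun z => inner ℝ x z - Φ z) := by
  obtain ⟨c, -, hc⟩ := hΦ.exists_mul_norm_le ‖x‖ (norm_nonneg x)
  refine ⟨c, ?_⟩
  rintro _ ⟨z, rfl⟩
  have := real_inner_le_norm x z
  have := hc z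
  simp only
  linarith

theorem inner_le (x z : EuclideanSpace ℝ (Fin n)) : inner ℝ x z ≤ legendre Φ x + Φ z := by
  have := le_ciSup (hΦ.bddAbove_legendre x) z
  simp only [legendre]
  linarith

theorem legendre_nonneg (x : EuclideanSpace ℝ (Fin n)) : 0 ≤ legendre Φ x := by
  simpa [hΦ.zero] using hΦ.inner_le x 0

theorem legendre_zero : legendre Φ 0 = 0 := by
  refine le_antisymm (ciSup_le fun z => ?_) (hΦ.legendre_nonneg 0)
  simpa using hΦ.nonneg z

theorem legendre_neg (x : EuclideanSpace ℝ (Fin n)) : legendre Φ (-x) = legendre Φ x := by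
  have : ∀ x, legendre Φ (-x) ≤ legendre Φ x := fun x => ciSup_le fun z => by
    have := hΦ.inner_le x (-z)
    rw [hΦ.even, inner_neg_right] at this
    rw [inner_neg_left]
    linarith
  refine le_antisymm (this x) ?_
  simpa using this (-x)

theorem convexOn_legendre : ConvexOn ℝ Set.univ (legendre Φ) := by
  refine ⟨convex_univ, fun x _ y _ a b ha hb hab => ciSup_le fun z => ?_⟩
  rw [inner_add_left, real_inner_smul_left, real_inner_smul_left, smul_eq_mul, smul_eq_mul]
  have h1 := mul_le_mul_of_nonneg_left (hΦ.inner_le x z) ha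
  have h2 := mul_le_mul_of_nonneg_left (hΦ.inner_le y z) hb
  have h3 : Φ z = a * Φ z + b * Φ z := by rw [← add_mul, hab, one_mul]
  linarith

theorem continuous_legendre : Continuous (legendre Φ) :=
  hΦ.convexOn_legendre.locallyLipschitz.continuous

theorem legendre_smul_le {c : ℝ} (hc0 : 0 ≤ c) (hc1 : c ≤ 1) (x : EuclideanSpace ℝ (Fin n)) :
    legendre Φ (c • x) ≤ c * legendre Φ x := by
  have := hΦ.convexOn_legendre.2 (Set.mem_univ x) (Set.mem_univ 0) hc0 (sub_nonneg.2 hc1) (by ring)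
  simpa [hΦ.legendre_zero] using this

theorem legendre_smul_mono {c d : ℝ} (hc0 : 0 ≤ c) (hcd : c ≤ d) (x : EuclideanSpace ℝ (Fin n)) :
    legendre Φ (c • x) ≤ legendre Φ (d • x) := by
  rcases hc0.eq_or_lt with rfl | hc
  · simpa [hΦ.legendre_zero] using hΦ.legendre_nonneg _
  have hd : 0 < d := hc.trans_le hcd
  have h1 := hΦ.legendre_smul_le (c := c / d) (by positivity) ((div_le_one hd).2 hcd) (d • x)
  rw [smul_smul, div_mul_cancel₀ _ hd.ne'] at h1
  refine h1.trans (mul_le_of_le_one_left (hΦ.legendre_nonneg _) ((div_le_one hd).2 hcd))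

theorem apply_smul_le {c : ℝ} (hc0 : 0 ≤ c) (hc1 : c ≤ 1) (x : EuclideanSpace ℝ (Fin n)) :
    Φ (c • x) ≤ c * Φ x := by
  have := hΦ.convex.2 (Set.mem_univ x) (Set.mem_univ 0) hc0 (sub_nonneg.2 hc1) (by ring)
  simpa [hΦ.zero] using this

/-- Equality case of Fenchel-Young: the tangent plane at `z` lies below `Φ`, so `z` attains the
supremum. -/
theorem legendre_gradient (z : EuclideanSpace ℝ (Fin n)) :
    legendre Φ (gradient Φ z) = inner ℝ (gradient Φ z) z - Φ z := by
  refine le_antisymm (ciSup_le fun y => ?_) (by linarith [hΦ.inner_le (gradient Φ z) z])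
  have := hΦ.convex.add_inner_gradient_le hΦ.differentiable z y
  rw [inner_sub_right] at this
  linarith

/-- If `Φ*(x) = 0`, then `Φ` and `Φ - x·` are both minimal at `0`, so both derivatives vanish there
and `x = 0`. Positivity allows clearing the denominator in `legendreRatio`. -/
theorem legendre_pos {x : EuclideanSpace ℝ (Fin n)} (hx : x ≠ 0) : 0 < legendre Φ x := by
  refine lt_of_le_of_ne (hΦ.legendre_nonneg x) fun h => hx ?_
  have m1 : IsLocalMin Φ 0 := .of_forall fun z => by simpa [hΦ.zero] using hΦ.nonneg z
  have m2 : IsLocalMin (fun z => Φ z - inner ℝ x z) 0 := .of_forall fun z => by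
    have := hΦ.inner_le x z
    simp only [hΦ.zero, inner_zero_right]
    linarith
  have d1 := (hΦ.differentiable 0).hasFDerivAt
  rw [m1.fderiv_eq_zero] at d1
  have d2 := m2.hasFDerivAt_eq_zero (d1.sub (innerSL ℝ x).hasFDerivAt)
  simpa using congrArg (fun L => L x) d2

theorem exists_legendre_ratio_le
    (hr : Tendsto (legendreRatio Φ) (𝓝[Set.Icc 0 1] 0) (𝓝 1)) {κ : ℝ} (hκ : 0 < κ) :
    ∃ α, 0 < α ∧ α < 1 ∧
      ∀ x, (1 - α) * legendre Φ ((1 - α)⁻¹ • x) ≤ (1 + κ) * legendre Φ x := by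
  have h1 : ∀ᶠ α in 𝓝[Set.Icc 0 1] (0 : ℝ), legendreRatio Φ α < ((1 + κ : ℝ) : EReal) :=
    hr.eventually (gt_mem_nhds (by rw [← EReal.coe_one, EReal.coe_lt_coe_iff]; linarith))
  -- Restricting to the open interval discards `α = 0`, which the filter on `Set.Icc 0 1` allows.
  have h2 : ∀ᶠ α in 𝓝[Set.Ioo 0 1] (0 : ℝ), legendreRatio Φ α < ((1 + κ : ℝ) : EReal) :=
    h1.filter_mono (nhdsWithin_mono _ Set.Ioo_subset_Icc_self)
  rw [nhdsWithin_Ioo_eq_nhdsGT one_pos] at h2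
  obtain ⟨α, hα, hα0, hα1⟩ := (h2.and (Ioo_mem_nhdsGT one_pos)).exists
  refine ⟨α, hα0, hα1, fun x => ?_⟩
  rcases eq_or_ne x 0 with rfl | hx
  · simp [hΦ.legendre_zero]
  have h3 := (le_iSup₂ (f := fun (x : EuclideanSpace ℝ (Fin n)) (_ : x ≠ 0) =>
    (((1 - α) * legendre Φ ((1 - α)⁻¹ • x) / legendre Φ x : ℝ) : EReal)) x hx).trans hα.le
  rw [EReal.coe_le_coe_iff, div_le_iff₀ (hΦ.legendre_pos hx)] at h3
  exact h3

/-- The pointwise inequality that turns the modified logarithmic Sobolev inequality into one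
whose remainder is an arbitrarily small multiple of the potential. -/
theorem exists_le_mul_add_legendre
    (hr : Tendsto (legendreRatio Φ) (𝓝[Set.Icc 0 1] 0) (𝓝 1)) {A : ℝ} (hA : 0 < A)
    (hgr : ∀ x, inner ℝ x (gradient Φ x) ≤ (A + 1) * Φ x) {δ : ℝ} (hδ : 0 < δ) :
    ∃ C : ℝ, 0 < C ∧ ∀ z p, inner ℝ p z + Φ z - inner ℝ (gradient Φ z) z + legendre Φ (gradient Φ z - p)
      ≤ δ * Φ z + 2 * legendre Φ (C • p) := by
  -- Since `Φ*(∇Φ) ≤ A Φ`, this `κ` costs `δ / 2 * Φ`; the other half of `δ` pays for Young's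
  -- inequality on `p·z`.
  obtain ⟨α, hα0, hα1, hα⟩ := hΦ.exists_legendre_ratio_le hr (κ := δ / (2 * A)) (by positivity)
  obtain ⟨l, hl0, hl1, hl2⟩ : ∃ l : ℝ, 0 < l ∧ l ≤ 1 ∧ l ≤ δ / 2 :=
    ⟨min 1 (δ / 2), by positivity, min_le_left _ _, min_le_right _ _⟩
  have hm0 : 0 < min l α := lt_min hl0 hα0
  refine ⟨(min l α)⁻¹, by positivity, fun z p => ?_⟩
  have h1 : inner ℝ p z ≤ legendre Φ ((min l α)⁻¹ • p) + l * Φ z := by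
    have h := hΦ.inner_le (l⁻¹ • p) (l • z)
    rw [real_inner_smul_left, real_inner_smul_right, inv_mul_cancel_left₀ hl0.ne'] at h
    linarith [hΦ.apply_smul_le hl0.le hl1 z, hΦ.legendre_smul_mono (inv_nonneg.2 hl0.le)
      (inv_anti₀ hm0 (min_le_left l α)) p]
  -- Here `∇Φ(z) - p` is the convex combination of `∇Φ(z) / (1 - α)` and `-p / α`.
  have hc := hΦ.convexOn_legendre.2 (Set.mem_univ ((1 - α)⁻¹ • gradient Φ z))
    (Set.mem_univ (-(α⁻¹ • p))) (sub_pos.2 hα1).le hα0.le (by ring)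
  rw [smul_neg, smul_smul, smul_smul, mul_inv_cancel₀ (sub_pos.2 hα1).ne', mul_inv_cancel₀ hα0.ne',
    one_smul, one_smul, ← sub_eq_add_neg, smul_eq_mul, smul_eq_mul, hΦ.legendre_neg] at hc
  have h2 : α * legendre Φ (α⁻¹ • p) ≤ legendre Φ ((min l α)⁻¹ • p) :=
    (mul_le_of_le_one_left (hΦ.legendre_nonneg _) hα1.le).trans
      (hΦ.legendre_smul_mono (inv_nonneg.2 hα0.le) (inv_anti₀ hm0 (min_le_right l α)) p)
  have h3 := hα (gradient Φ z)
  have h4 : δ / (2 * A) * legendre Φ (gradient Φ z) ≤ δ / 2 * Φ z := by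
    have h : legendre Φ (gradient Φ z) ≤ A * Φ z := by
      rw [hΦ.legendre_gradient]
      have := hgr z
      rw [real_inner_comm] at this
      linarith
    calc _ ≤ δ / (2 * A) * (A * Φ z) := by gcongr
      _ = _ := by field_simp
  have h5 := hΦ.legendre_gradient z
  have h6 := mul_le_mul_of_nonneg_right hl2 (hΦ.nonneg z)
  linarith

end IsPotential

/-! ### Integrability and Prékopa-Leindler for the Gibbs measure -/

namespace IsPotential

variable {Φ : EuclideanSpace ℝ (Fin n) → ℝ} (hΦ : IsPotential Φ)
include hΦ

/-- Superlinearity gives `Φ / 2 ≥ (n + 1)‖x‖ - const`, and `(1 + ‖x‖)^(-(n+1))` is integrable. The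
half left over makes `exp (Φ / 2)` integrable for `gibbs Φ`, the domination used throughout. -/
theorem integrable_exp_neg_half : Integrable fun x => Real.exp (-(Φ x / 2)) := by
  obtain ⟨c, -, hc⟩ := hΦ.exists_mul_norm_le (2 * (n + 1)) (by positivity)
  have h1 : Integrable fun x : EuclideanSpace ℝ (Fin n) =>
      Real.exp (c / 2) * (1 + ‖x‖) ^ (-(n + 1 : ℝ)) :=
    (integrable_one_add_norm (by simp)).const_mul _
  refine h1.mono' (by have := hΦ.continuous; fun_prop) (.of_forall fun x => ?_)
  rw [Real.norm_eq_abs, Real.abs_exp, Real.rpow_neg (by positivity)]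
  have h2 : (1 + ‖x‖) ^ (n + 1 : ℝ) ≤ Real.exp ((n + 1) * ‖x‖) := by
    rw [mul_comm, Real.exp_mul]
    exact Real.rpow_le_rpow (by positivity) (by linarith [Real.add_one_le_exp ‖x‖]) (by positivity)
  calc Real.exp (-(Φ x / 2)) ≤ Real.exp (c / 2 + -((n + 1) * ‖x‖)) :=
        Real.exp_le_exp.2 (by linarith [hc x])
    _ = Real.exp (c / 2) * (Real.exp ((n + 1) * ‖x‖))⁻¹ := by rw [Real.exp_add, Real.exp_neg]
    _ ≤ _ := by gcongr

theorem integrable_exp_neg : Integrable fun x => Real.exp (-Φ x) := by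
  refine hΦ.integrable_exp_neg_half.mono' (by have := hΦ.continuous; fun_prop)
    (.of_forall fun x => ?_)
  rw [Real.norm_eq_abs, Real.abs_exp]
  exact Real.exp_le_exp.2 (by linarith [hΦ.nonneg x])

theorem partitionFn_pos : 0 < partitionFn Φ := integral_exp_pos hΦ.integrable_exp_neg

theorem exp_div_partitionFn (x : EuclideanSpace ℝ (Fin n)) :
    Real.exp (-Φ x) / partitionFn Φ = Real.exp (-Φ x - Real.log (partitionFn Φ)) := by
  rw [Real.exp_sub, Real.exp_log hΦ.partitionFn_pos]

theorem isProbabilityMeasure_gibbs : IsProbabilityMeasure (gibbs Φ) := by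
  refine ⟨?_⟩
  rw [gibbs, withDensity_apply _ .univ, Measure.restrict_univ,
    ← ofReal_integral_eq_lintegral_ofReal (hΦ.integrable_exp_neg.div_const _)
      (.of_forall fun x => div_nonneg (Real.exp_pos _).le hΦ.partitionFn_pos.le),
    integral_div, ← partitionFn, div_self hΦ.partitionFn_pos.ne', ENNReal.ofReal_one]

theorem lintegral_gibbs_exp {u : EuclideanSpace ℝ (Fin n) → ℝ} (hu : Measurable u) :
    ∫⁻ x, ENNReal.ofReal (Real.exp (u x)) ∂(gibbs Φ) =
      ∫⁻ x, ENNReal.ofReal (Real.exp (u x - Φ x - Real.log (partitionFn Φ))) := by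
  have := hΦ.continuous.measurable
  rw [gibbs, lintegral_withDensity_eq_lintegral_mul _ (by fun_prop) (by fun_prop)]
  refine lintegral_congr fun x => ?_
  rw [Pi.mul_apply, hΦ.exp_div_partitionFn, ← ENNReal.ofReal_mul (Real.exp_pos _).le,
    ← Real.exp_add]
  ring_nf

theorem integrable_exp_half_gibbs : Integrable (fun x => Real.exp (Φ x / 2)) (gibbs Φ) := by
  have hm := hΦ.continuous.measurable
  refine ⟨by fun_prop, ?_⟩
  rw [hasFiniteIntegral_iff_ofReal (.of_forall fun x => (Real.exp_pos _).le),
    hΦ.lintegral_gibbs_exp (by fun_prop)]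
  have h := (hΦ.integrable_exp_neg_half.const_mul (partitionFn Φ)⁻¹).lintegral_lt_top
  convert h using 4 with x
  rw [show Φ x / 2 - Φ x - Real.log (partitionFn Φ) = -(Φ x / 2) - Real.log (partitionFn Φ) by ring,
    Real.exp_sub, Real.exp_log hΦ.partitionFn_pos]
  ring

/-- The Prékopa-Leindler inequality for the measure `gibbs Φ`. -/
theorem gibbs_prekopaLeindler {t s : ℝ} (ht : 0 < t) (hs : 0 < s) (hts : t + s = 1)
    {u h : EuclideanSpace ℝ (Fin n) → ℝ} (hu : Measurable u) (hh : Measurable h)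
    (H : ∀ x y, u x - t * Φ x - s * Φ y ≤ h (t • x + s • y) - Φ (t • x + s • y)) :
    (∫⁻ x, ENNReal.ofReal (Real.exp (u x / t)) ∂(gibbs Φ)) ^ t ≤
      ∫⁻ x, ENNReal.ofReal (Real.exp (h x)) ∂(gibbs Φ) := by
  have := hΦ.isProbabilityMeasure_gibbs
  have hm := hΦ.continuous.measurable
  -- The second function is the Gibbs density itself; its mass `1` removes its factor.
  have h1 : ∫⁻ x, ENNReal.ofReal (Real.exp (0 - Φ x - Real.log (partitionFn Φ))) = 1 := by
    rw [← hΦ.lintegral_gibbs_exp measurable_const]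
    simp
  rw [hΦ.lintegral_gibbs_exp (by fun_prop), hΦ.lintegral_gibbs_exp hh]
  have := prekopaLeindler_euclidean ht hs hts
    (f := fun x => ENNReal.ofReal (Real.exp (u x / t - Φ x - Real.log (partitionFn Φ))))
    (g := fun x => ENNReal.ofReal (Real.exp (0 - Φ x - Real.log (partitionFn Φ))))
    (h := fun x => ENNReal.ofReal (Real.exp (h x - Φ x - Real.log (partitionFn Φ))))
    (by fun_prop) (by fun_prop) (by fun_prop) fun x y => by
      rw [ENNReal.ofReal_rpow_of_pos (Real.exp_pos _), ENNReal.ofReal_rpow_of_pos (Real.exp_pos _),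
        ← ENNReal.ofReal_mul (by positivity), ← Real.exp_mul, ← Real.exp_mul, ← Real.exp_add]
      refine ENNReal.ofReal_le_ofReal (Real.exp_le_exp.2 ?_)
      have e : (u x / t - Φ x - Real.log (partitionFn Φ)) * t
          + (0 - Φ y - Real.log (partitionFn Φ)) * s
          = u x - t * Φ x - s * Φ y - (t + s) * Real.log (partitionFn Φ) := by
        field_simp
        ring
      rw [e, hts, one_mul]
      linarith [H x y]
  rwa [h1, ENNReal.one_rpow, mul_one] at this

end IsPotential

/-! ### Sup-convolution and the inequality for bounded functions with bounded gradient -/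

/-- A Jensen inequality: `exp (c ∫ g e^g) ≤ ∫ e^{(1 + c) g}` when `e^g` is a probability density. -/
theorem exp_mul_integral_le {α : Type*} [MeasurableSpace α] {μ : Measure α} {g : α → ℝ} (c : ℝ)
    (h0 : Integrable (fun x => Real.exp (g x)) μ)
    (h1 : Integrable (fun x => g x * Real.exp (g x)) μ)
    (h2 : Integrable (fun x => Real.exp ((1 + c) * g x)) μ)
    (hg : ∫ x, Real.exp (g x) ∂μ = 1) :
    Real.exp (c * ∫ x, g x * Real.exp (g x) ∂μ) ≤ ∫ x, Real.exp ((1 + c) * g x) ∂μ := by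
  set m := ∫ x, g x * Real.exp (g x) ∂μ with hm
  -- Tangent line of `exp` at `c * m`, evaluated at `c * g x` and weighted by `e^g`.
  have h3 : ∀ x, Real.exp (c * m) * ((1 - c * m) * Real.exp (g x) + c * (g x * Real.exp (g x)))
      ≤ Real.exp ((1 + c) * g x) := fun x => by
    have h4 := Real.add_one_le_exp (c * g x - c * m)
    have e : Real.exp ((1 + c) * g x) =
        Real.exp (c * m) * (Real.exp (c * g x - c * m) * Real.exp (g x)) := by
      rw [← Real.exp_add, ← Real.exp_add]; ring_nf
    rw [e]
    gcongr
    nlinarith [mul_le_mul_of_nonneg_right h4 (Real.exp_pos (g x)).le]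
  have h5 := integral_mono (((h0.const_mul _).add (h1.const_mul _)).const_mul _) h2 h3
  simp only [Pi.add_apply] at h5
  rw [integral_const_mul, integral_add (h0.const_mul _) (h1.const_mul _), integral_const_mul,
    integral_const_mul, hg, ← hm] at h5
  rwa [show (1 - c * m) * 1 + c * m = 1 by ring, mul_one] at h5

/-- The difference quotient whose supremum over `y` governs the sup-convolution of `g`
with weight `s`. -/
def supConvQuotient (Φ g : EuclideanSpace ℝ (Fin n) → ℝ) (s : ℝ)
    (z y : EuclideanSpace ℝ (Fin n)) : ℝ :=
  s⁻¹ * (g (z + (s / (1 - s)) • (z - y)) - g z - (1 - s) * Φ (z + (s / (1 - s)) • (z - y))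
    - s * Φ y + Φ z)

namespace IsPotential

variable {Φ : EuclideanSpace ℝ (Fin n) → ℝ} (hΦ : IsPotential Φ)
include hΦ

/-- With `x = z + (s/(1-s))(z - y)`, the mean value theorem handles `g x - g z` and the tangent
plane of `Φ` at `z` bounds `Φ x` from below. The weights cancel the factor `s⁻¹`. -/
theorem supConvQuotient_le {g : EuclideanSpace ℝ (Fin n) → ℝ} (hg : Differentiable ℝ g) {s : ℝ}
    (hs0 : 0 < s) (hs1 : s < 1) (z y : EuclideanSpace ℝ (Fin n)) :
    ∃ ξ, ‖ξ - z‖ ≤ s / (1 - s) * ‖z - y‖ ∧ supConvQuotient Φ g s z y ≤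
      inner ℝ ((1 - s)⁻¹ • gradient g ξ) (z - y) - Φ y + Φ z + inner ℝ (gradient Φ z) (y - z) := by
  have ht : 0 < 1 - s := sub_pos.2 hs1
  set x := z + (s / (1 - s)) • (z - y) with hx
  obtain ⟨ξ, hξ, he⟩ := domain_mvt (f := g) (f' := fun x => fderiv ℝ g x) (s := Set.univ) (x := z)
    (y := x) (fun x _ => (hg x).hasFDerivAt.hasFDerivWithinAt) convex_univ (Set.mem_univ _)
    (Set.mem_univ _)
  have hxz : x - z = (s / (1 - s)) • (z - y) := by rw [hx, add_sub_cancel_left]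
  refine ⟨ξ, ?_, ?_⟩
  · have := norm_sub_le_of_mem_segment hξ
    rwa [hxz, norm_smul, Real.norm_of_nonneg (by positivity)] at this
  · rw [← inner_gradient_left, hxz, real_inner_smul_right] at he
    have hc := hΦ.convex.add_inner_gradient_le hΦ.differentiable z x
    rw [hxz, real_inner_smul_right] at hc
    have hc' := mul_le_mul_of_nonneg_left hc ht.le
    have e : (1 - s) * (s / (1 - s)) = s := by field_simp
    have e2 : inner ℝ (gradient Φ z) (y - z) = - inner ℝ (gradient Φ z) (z - y) := by
      rw [← inner_neg_right, neg_sub]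
    rw [supConvQuotient, ← hx, inv_mul_le_iff₀ hs0, real_inner_smul_left, he, e2]
    rw [mul_add, ← mul_assoc, e] at hc'
    have e3 : s / (1 - s) * inner ℝ (gradient g ξ) (z - y)
        = s * ((1 - s)⁻¹ * inner ℝ (gradient g ξ) (z - y)) := by
      rw [div_eq_mul_inv, mul_assoc]
    rw [e3]
    linarith

/-- With `p = ∇g(ξ)/(1-s)`, Fenchel-Young eliminates `y` and leaves exactly the left side of `hkey`.
The bound `(1-s)⁻¹ ≤ 2` turns `C` into `2 * C`. -/
theorem supConvQuotient_le_legendre {g : EuclideanSpace ℝ (Fin n) → ℝ} (hg : Differentiable ℝ g)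
    {δ C : ℝ} (hC : 0 < C)
    (hkey : ∀ z p, inner ℝ p z + Φ z - inner ℝ (gradient Φ z) z + legendre Φ (gradient Φ z - p)
      ≤ δ * Φ z + 2 * legendre Φ (C • p)) {s : ℝ} (hs0 : 0 < s) (hs1 : s ≤ 1 / 2)
    (z y : EuclideanSpace ℝ (Fin n)) :
    ∃ ξ, ‖ξ - z‖ ≤ s / (1 - s) * ‖z - y‖ ∧ supConvQuotient Φ g s z y ≤
      δ * Φ z + 2 * legendre Φ ((2 * C) • gradient g ξ) := by
  obtain ⟨ξ, h1, h2⟩ := hΦ.supConvQuotient_le hg hs0 (by linarith) z y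
  refine ⟨ξ, h1, h2.trans ?_⟩
  set p := (1 - s)⁻¹ • gradient g ξ with hp
  have h3 := hkey z p
  have h4 := hΦ.inner_le (gradient Φ z - p) y
  have h5 : legendre Φ (C • p) ≤ legendre Φ ((2 * C) • gradient g ξ) := by
    rw [hp, smul_smul, mul_comm 2 C]
    have : (1 - s)⁻¹ ≤ 2 := inv_le_of_inv_le₀ (by norm_num) (by linarith)
    have : 0 ≤ (1 - s)⁻¹ := inv_nonneg.2 (by linarith)
    exact hΦ.legendre_smul_mono (by positivity) (by gcongr) _
  rw [inner_sub_left] at h4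
  rw [inner_sub_right, inner_sub_right]
  linarith

/-- For `y` within `R` of `z`, the mean value point `ξ` tends to `z` uniformly in `y`. For `y`
farther away, superlinearity of `Φ` makes the quotient negative. -/
theorem eventually_supConvQuotient_le {g : EuclideanSpace ℝ (Fin n) → ℝ} (hg : ContDiff ℝ 1 g)
    {L : ℝ} (hL : ∀ x, ‖gradient g x‖ ≤ L) {δ C : ℝ} (hδ : 0 < δ) (hC : 0 < C)
    (hkey : ∀ z p, inner ℝ p z + Φ z - inner ℝ (gradient Φ z) z + legendre Φ (gradient Φ z - p)
      ≤ δ * Φ z + 2 * legendre Φ (C • p)) (z : EuclideanSpace ℝ (Fin n)) {ε : ℝ} (hε : 0 < ε) :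
    ∀ᶠ s in 𝓝[>] (0 : ℝ), ∀ y, supConvQuotient Φ g s z y ≤
      δ * Φ z + 2 * legendre Φ ((2 * C) • gradient g z) + ε := by
  have hgd := hg.differentiable (by simp)
  have hL0 : 0 ≤ L := (norm_nonneg _).trans (hL 0)
  obtain ⟨c, hc0, hc⟩ := hΦ.exists_mul_norm_le (2 * L + ‖gradient Φ z‖ + 1) (by positivity)
  -- Chosen so that the quotient is at most `R - ‖z - y‖` for small `s`.
  set R := (2 * L + ‖gradient Φ z‖ + 1) * ‖z‖ + c + Φ z with hR
  have hgc : Continuous (gradient g) :=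
    (InnerProductSpace.toDual ℝ _).symm.continuous.comp (hg.continuous_fderiv (by simp))
  have hcont : Continuous fun x => 2 * legendre Φ ((2 * C) • gradient g x) := by
    have := hΦ.continuous_legendre
    fun_prop
  obtain ⟨r, hr0, hr⟩ := Metric.continuous_iff.1 hcont z ε hε
  have hlim : Tendsto (fun s : ℝ => s / (1 - s) * R) (𝓝[>] 0) (𝓝 0) := by
    have : ContinuousAt (fun s : ℝ => s / (1 - s) * R) 0 := by
      refine ContinuousAt.mul (ContinuousAt.div (by fun_prop) (by fun_prop) (by simp)) (by fun_prop)
    simpa using this.tendsto.mono_left nhdsWithin_le_nhds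
  have e2 : ∀ᶠ s : ℝ in 𝓝[>] 0, s ∈ Set.Ioo (0 : ℝ) (1 / 2) := Ioo_mem_nhdsGT (by norm_num)
  filter_upwards [hlim.eventually (gt_mem_nhds hr0), e2] with s hsR ⟨hs0, hs1⟩ y
  have ht : 0 < 1 - s := by linarith
  rcases le_or_gt ‖z - y‖ R with hy | hy
  · obtain ⟨ξ, h1, h2⟩ := hΦ.supConvQuotient_le_legendre hgd hC hkey hs0 hs1.le z y
    have h3 : dist ξ z < r := by
      rw [dist_eq_norm]
      refine h1.trans_lt (lt_of_le_of_lt ?_ hsR)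
      gcongr
    have h4 := (abs_lt.1 (Real.dist_eq _ _ ▸ hr ξ h3)).2
    linarith
  · obtain ⟨ξ, -, h2⟩ := hΦ.supConvQuotient_le hgd hs0 (by linarith) z y
    have h3 : inner ℝ ((1 - s)⁻¹ • gradient g ξ) (z - y) ≤ 2 * L * ‖z - y‖ := by
      refine (real_inner_le_norm _ _).trans ?_
      rw [norm_smul, norm_inv, Real.norm_of_nonneg ht.le]
      have : (1 - s)⁻¹ ≤ 2 := inv_le_of_inv_le₀ (by norm_num) (by linarith)
      gcongr
      exact hL ξ
    have h4 : inner ℝ (gradient Φ z) (y - z) ≤ ‖gradient Φ z‖ * ‖z - y‖ := by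
      rw [norm_sub_rev]
      exact real_inner_le_norm _ _
    have h5 := hc y
    have h6 : (2 * L + ‖gradient Φ z‖ + 1) * ‖z - y‖
        ≤ (2 * L + ‖gradient Φ z‖ + 1) * (‖z‖ + ‖y‖) := by
      gcongr
      exact norm_sub_le z y
    have h7 := hΦ.legendre_nonneg ((2 * C) • gradient g z)
    have h8 : 0 ≤ δ * Φ z := mul_nonneg hδ.le (hΦ.nonneg z)
    linarith

/-- The modified logarithmic Sobolev inequality for bounded functions with bounded gradient. -/
theorem integral_mul_exp_le_of_bounded {g : EuclideanSpace ℝ (Fin n) → ℝ} (hg : ContDiff ℝ 1 g)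
    {L M : ℝ} (hL : ∀ x, ‖gradient g x‖ ≤ L) (hM : ∀ x, |g x| ≤ M) {δ C : ℝ} (hδ : 0 < δ)
    (hδ' : δ ≤ 1 / 4) (hC : 0 < C)
    (hkey : ∀ z p, inner ℝ p z + Φ z - inner ℝ (gradient Φ z) z + legendre Φ (gradient Φ z - p)
      ≤ δ * Φ z + 2 * legendre Φ (C • p)) (hg1 : ∫ x, Real.exp (g x) ∂(gibbs Φ) = 1) :
    ∫ x, g x * Real.exp (g x) ∂(gibbs Φ) ≤
      ∫ x, (δ * Φ x + 2 * legendre Φ ((2 * C) • gradient g x)) * Real.exp (g x) ∂(gibbs Φ) := by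
  have := hΦ.isProbabilityMeasure_gibbs
  have hΦc := hΦ.continuous
  have hΦm := hΦc.measurable
  have hgm := hg.continuous.measurable
  have hgd := hg.differentiable (by simp)
  have hgc : Continuous (gradient g) :=
    (InnerProductSpace.toDual ℝ _).symm.continuous.comp (hg.continuous_fderiv (by simp))
  have hlc := hΦ.continuous_legendre
  set W := fun x => δ * Φ x + 2 * legendre Φ ((2 * C) • gradient g x) with hW
  have hWm : Measurable W := (by fun_prop : Continuous W).measurable
  obtain ⟨D, hD⟩ := (isCompact_closedBall (0 : EuclideanSpace ℝ (Fin n)) L).exists_bound_of_continuousOn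
    (f := fun v => 2 * legendre Φ ((2 * C) • v)) (by fun_prop)
  have hD' : ∀ x, 2 * legendre Φ ((2 * C) • gradient g x) ≤ D := fun x =>
    (le_abs_self _).trans (hD _ (by simpa using hL x))
  have hbB : ∀ s, 0 < s → s ≤ 1 / 2 → ∀ z y, supConvQuotient Φ g s z y ≤ δ * Φ z + D := by
    intro s hs0 hs1 z y
    obtain ⟨ξ, -, h⟩ := hΦ.supConvQuotient_le_legendre hgd hC hkey hs0 hs1 z y
    linarith [hD' ξ]
  have hbdd : ∀ s, 0 < s → s ≤ 1 / 2 → ∀ z, BddAbove (Set.range (supConvQuotient Φ g s z)) := by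
    intro s hs0 hs1 z
    exact ⟨δ * Φ z + D, Set.forall_mem_range.2 (hbB s hs0 hs1 z)⟩
  -- The maximum with `W` makes `k` nonnegative and bounded below by its limit, so only an upper
  -- estimate is needed for convergence.
  set k : ℝ → EuclideanSpace ℝ (Fin n) → ℝ :=
    fun s z => max (⨆ y, supConvQuotient Φ g s z y) (W z) with hk
  have hkm : ∀ s, 0 < s → s ≤ 1 / 2 → Measurable (k s) := by
    intro s hs0 hs1
    refine Measurable.max (LowerSemicontinuous.measurable ?_) hWm
    refine lowerSemicontinuous_ciSup (hbdd s hs0 hs1) fun y => Continuous.lowerSemicontinuous ?_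
    have := hg.continuous
    have := hΦ.continuous
    unfold supConvQuotient
    fun_prop
  have hkB : ∀ s, 0 < s → s ≤ 1 / 2 → ∀ z, k s z ≤ δ * Φ z + D := fun s hs0 hs1 z =>
    max_le (ciSup_le (hbB s hs0 hs1 z)) (by simp only [hW]; linarith [hD' z])
  have hk0 : ∀ s z, 0 ≤ k s z := fun s z => le_max_of_le_right
    (add_nonneg (mul_nonneg hδ.le (hΦ.nonneg z)) (mul_nonneg zero_le_two (hΦ.legendre_nonneg _)))
  have hklim : ∀ z, Tendsto (fun s => k s z) (𝓝[>] 0) (𝓝 (W z)) := by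
    intro z
    rw [Metric.tendsto_nhds]
    intro ε hε
    filter_upwards [hΦ.eventually_supConvQuotient_le hg hL hδ hC hkey z (half_pos hε)] with s hs
    have h1 : k s z ≤ W z + ε / 2 := max_le (ciSup_le hs) (by linarith)
    have h2 : W z ≤ k s z := le_max_right _ _
    rw [Real.dist_eq, abs_lt]
    constructor <;> linarith
  have hdom := hΦ.integrable_exp_half_gibbs.const_mul (Real.exp (2 * D) * Real.exp M)
  -- As `δ ≤ 1 / 4`, `2 * k` is at most `2 * D + Φ / 2`, and `exp (Φ / 2)` is integrable.
  have hbound : ∀ s, 0 < s → s ≤ 1 / 2 → ∀ z, k s z * Real.exp (s * k s z) * Real.exp (g z) ≤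
      Real.exp (2 * D) * Real.exp M * Real.exp (Φ z / 2) := by
    intro s hs0 hs1 z
    have h1 : k s z ≤ Real.exp (k s z) := by linarith [Real.add_one_le_exp (k s z)]
    have h2 : s * k s z ≤ k s z := mul_le_of_le_one_left (hk0 s z) (by linarith)
    calc k s z * Real.exp (s * k s z) * Real.exp (g z)
        ≤ Real.exp (k s z) * Real.exp (k s z) * Real.exp M := by
          gcongr
          exact (le_abs_self _).trans (hM z)
      _ = Real.exp (2 * k s z) * Real.exp M := by rw [← Real.exp_add, two_mul]
      _ ≤ Real.exp (2 * D + Φ z / 2) * Real.exp M := by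
          gcongr
          nlinarith [hkB s hs0 hs1 z, mul_le_mul_of_nonneg_right hδ' (hΦ.nonneg z)]
      _ = _ := by rw [Real.exp_add]; ring
  have hexpb : ∀ c : ℝ, Integrable (fun x => Real.exp (c * g x)) (gibbs Φ) := fun c =>
    Integrable.of_bound (by fun_prop) (Real.exp (|c| * M)) (.of_forall fun x => by
      rw [Real.norm_eq_abs, Real.abs_exp, Real.exp_le_exp]
      refine (le_abs_self _).trans ?_
      rw [abs_mul]
      exact mul_le_mul_of_nonneg_left (hM x) (abs_nonneg _))
  have hexp1 : Integrable (fun x => Real.exp (g x)) (gibbs Φ) := by simpa using hexpb 1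
  have hgexp : Integrable (fun x => g x * Real.exp (g x)) (gibbs Φ) :=
    hexp1.bdd_mul (c := M) (by fun_prop) (.of_forall hM)
  set m := ∫ x, g x * Real.exp (g x) ∂(gibbs Φ) with hm
  have hFi : ∀ s, 0 < s → s ≤ 1 / 2 →
      Integrable (fun z => k s z * Real.exp (s * k s z) * Real.exp (g z)) (gibbs Φ) := by
    intro s hs0 hs1
    have := hkm s hs0 hs1
    refine hdom.mono' (by fun_prop) (.of_forall fun z => ?_)
    rw [Real.norm_of_nonneg (mul_nonneg (mul_nonneg (hk0 s z) (Real.exp_pos _).le)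
      (Real.exp_pos _).le)]
    exact hbound s hs0 hs1 z
  have hmain : ∀ s, 0 < s → s ≤ 1 / 2 →
      m ≤ ∫ z, k s z * Real.exp (s * k s z) * Real.exp (g z) ∂(gibbs Φ) := by
    intro s hs0 hs1
    have ht : 0 < 1 - s := by linarith
    have hkms := hkm s hs0 hs1
    have h1 := hΦ.gibbs_prekopaLeindler (t := 1 - s) ht hs0 (by ring) hgm
      (h := fun z => g z + s * k s z) (by fun_prop) (by
        intro x y
        set z := (1 - s) • x + s • y with hz
        -- The quotient is parametrized by the midpoint `z` and `y`; this recovers the other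
        -- endpoint `x`.
        have hx : z + (s / (1 - s)) • (z - y) = x := by
          have : z - y = (1 - s) • (x - y) := by rw [hz]; module
          rw [this, smul_smul, div_mul_cancel₀ _ ht.ne', hz]
          module
        have h2 : supConvQuotient Φ g s z y ≤ k s z :=
          le_max_of_le_left (le_ciSup (hbdd s hs0 hs1 z) y)
        rw [supConvQuotient, hx, inv_mul_le_iff₀ hs0] at h2
        linarith)
    have h2 := exp_mul_integral_le (s / (1 - s)) hexp1 hgexp (hexpb _) hg1
    rw [← hm] at h2
    have e1 : ∀ x, (1 + s / (1 - s)) * g x = g x / (1 - s) := fun x => by field_simp; ring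
    simp only [e1] at h2
    have hint : Integrable (fun x => Real.exp (g x / (1 - s))) (gibbs Φ) := by
      simpa only [e1] using hexpb (1 + s / (1 - s))
    rw [← ofReal_integral_eq_lintegral_ofReal hint (.of_forall fun _ => (Real.exp_pos _).le)] at h1
    have h3 : ENNReal.ofReal (Real.exp (s * m)) ≤
        ENNReal.ofReal (∫ x, Real.exp (g x / (1 - s)) ∂(gibbs Φ)) ^ (1 - s) := by
      rw [ENNReal.ofReal_rpow_of_pos (integral_exp_pos hint)]
      refine ENNReal.ofReal_le_ofReal ?_
      have e2 : s * m = s / (1 - s) * m * (1 - s) := by field_simp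
      rw [e2, Real.exp_mul]
      exact Real.rpow_le_rpow (Real.exp_pos _).le h2 ht.le
    -- From `e^u ≤ 1 + u e^u`: the right side becomes `1 + s ∫ k e^{sk} e^g`, against `1 + s * m` on
    -- the left, so dividing by `s` gives the claim.
    have hle : ∀ z, Real.exp (g z + s * k s z) ≤
        Real.exp (g z) + s * (k s z * Real.exp (s * k s z) * Real.exp (g z)) := fun z => by
      have h4 := Real.add_one_le_exp (-(s * k s z))
      rw [Real.exp_neg] at h4
      have h5 : Real.exp (s * k s z) ≤ 1 + s * k s z * Real.exp (s * k s z) := by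
        have h6 := mul_le_mul_of_nonneg_right h4 (Real.exp_pos (s * k s z)).le
        rw [inv_mul_cancel₀ (Real.exp_pos _).ne'] at h6
        linarith
      rw [Real.exp_add, mul_comm]
      refine (mul_le_mul_of_nonneg_right h5 (Real.exp_pos (g z)).le).trans (le_of_eq ?_)
      ring
    have hRi : Integrable (fun z => Real.exp (g z) +
        s * (k s z * Real.exp (s * k s z) * Real.exp (g z))) (gibbs Φ) := hexp1.add ((hFi s hs0 hs1).const_mul s)
    have h7 : ENNReal.ofReal (Real.exp (s * m)) ≤ ENNReal.ofReal (∫ z, (Real.exp (g z) +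
        s * (k s z * Real.exp (s * k s z) * Real.exp (g z))) ∂(gibbs Φ)) := by
      refine (h3.trans h1).trans ?_
      rw [ofReal_integral_eq_lintegral_ofReal hRi
        (.of_forall fun z => (Real.exp_pos _).le.trans (hle z))]
      exact lintegral_mono fun z => ENNReal.ofReal_le_ofReal (hle z)
    have h8 : 0 ≤ ∫ z, (Real.exp (g z) +
        s * (k s z * Real.exp (s * k s z) * Real.exp (g z))) ∂(gibbs Φ) :=
      integral_nonneg fun z => (Real.exp_pos _).le.trans (hle z)
    rw [ENNReal.ofReal_le_ofReal_iff h8, integral_add hexp1 ((hFi s hs0 hs1).const_mul s), hg1,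
      integral_const_mul] at h7
    have h9 := Real.add_one_le_exp (s * m)
    exact le_of_mul_le_mul_left (by linarith) hs0
  have hev : ∀ᶠ s : ℝ in 𝓝[>] 0, 0 < s ∧ s ≤ 1 / 2 := by
    filter_upwards [Ioo_mem_nhdsGT (show (0 : ℝ) < 1 / 2 by norm_num)] with s hs
    exact ⟨hs.1, hs.2.le⟩
  refine ge_of_tendsto (tendsto_integral_filter_of_dominated_convergence _ ?_ ?_ hdom ?_)
    (hev.mono fun s hs => hmain s hs.1 hs.2)
  · exact hev.mono fun s hs => (hFi s hs.1 hs.2).aestronglyMeasurable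
  · refine hev.mono fun s hs => .of_forall fun z => ?_
    rw [Real.norm_of_nonneg (mul_nonneg (mul_nonneg (hk0 s z) (Real.exp_pos _).le)
      (Real.exp_pos _).le)]
    exact hbound s hs.1 hs.2 z
  · refine .of_forall fun z => Tendsto.mul_const _ ?_
    have h1 : Tendsto (fun s : ℝ => s * k s z) (𝓝[>] 0) (𝓝 (0 * W z)) :=
      (tendsto_id.mono_left nhdsWithin_le_nhds).mul (hklim z)
    have h2 := (hklim z).mul ((Real.continuous_exp.tendsto _).comp h1)
    simpa using h2

end IsPotential

/-! ### Removing the gradient bound by spatial cutoff -/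

theorem ContDiff.continuous_gradient {g : EuclideanSpace ℝ (Fin n) → ℝ} (hg : ContDiff ℝ 1 g) :
    Continuous (gradient g) :=
  (InnerProductSpace.toDual ℝ _).symm.continuous.comp (hg.continuous_fderiv (by simp))

theorem HasCompactSupport.exists_norm_gradient_le {g : EuclideanSpace ℝ (Fin n) → ℝ}
    (hc : HasCompactSupport g) (hg : ContDiff ℝ 1 g) : ∃ L, ∀ x, ‖gradient g x‖ ≤ L := by
  obtain ⟨L, hL⟩ := (hc.fderiv ℝ).exists_bound_of_continuous (hg.continuous_fderiv (by simp))
  exact ⟨L, fun x => by simpa [gradient] using hL x⟩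

theorem gradient_mul {f g : EuclideanSpace ℝ (Fin n) → ℝ} {x : EuclideanSpace ℝ (Fin n)}
    (hf : DifferentiableAt ℝ f x) (hg : DifferentiableAt ℝ g x) :
    gradient (fun y => f y * g y) x = f x • gradient g x + g x • gradient f x := by
  simp [gradient, fderiv_fun_mul hf hg]

theorem gradient_comp_real {g : EuclideanSpace ℝ (Fin n) → ℝ} {T : ℝ → ℝ} {T' : ℝ}
    {x : EuclideanSpace ℝ (Fin n)} (hT : HasDerivAt T T' (g x)) (hg : DifferentiableAt ℝ g x) :
    gradient (fun y => T (g y)) x = T' • gradient g x := by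
  have := (hT.comp_hasFDerivAt x hg.hasFDerivAt).fderiv
  simp only [Function.comp_def] at this
  simp [gradient, this]

namespace IsPotential

variable {Φ : EuclideanSpace ℝ (Fin n) → ℝ} (hΦ : IsPotential Φ)
include hΦ

theorem integrable_gibbs : Integrable Φ (gibbs Φ) := by
  refine (hΦ.integrable_exp_half_gibbs.const_mul 2).mono'
    hΦ.continuous.measurable.aestronglyMeasurable (.of_forall fun x => ?_)
  rw [Real.norm_of_nonneg (hΦ.nonneg x)]
  linarith [Real.add_one_le_exp (Φ x / 2)]

/-- Subtracting `log ∫ e^g` normalizes `g` without changing its gradient. The homogeneous form is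
needed because cutoffs and truncations destroy the normalization. -/
theorem entropy_le_of_bounded {g : EuclideanSpace ℝ (Fin n) → ℝ} (hg : ContDiff ℝ 1 g)
    {L M : ℝ} (hL : ∀ x, ‖gradient g x‖ ≤ L) (hM : ∀ x, |g x| ≤ M) {δ C : ℝ} (hδ : 0 < δ)
    (hδ' : δ ≤ 1 / 4) (hC : 0 < C)
    (hkey : ∀ z p, inner ℝ p z + Φ z - inner ℝ (gradient Φ z) z + legendre Φ (gradient Φ z - p)
      ≤ δ * Φ z + 2 * legendre Φ (C • p)) :
    ∫ x, g x * Real.exp (g x) ∂(gibbs Φ)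
        - (∫ x, Real.exp (g x) ∂(gibbs Φ)) * Real.log (∫ x, Real.exp (g x) ∂(gibbs Φ)) ≤
      ∫ x, (δ * Φ x + 2 * legendre Φ ((2 * C) • gradient g x)) * Real.exp (g x) ∂(gibbs Φ) := by
  have := hΦ.isProbabilityMeasure_gibbs
  have hgm := hg.continuous.measurable
  have h1 : Integrable (fun x => Real.exp (g x)) (gibbs Φ) :=
    Integrable.of_bound (by fun_prop) (Real.exp M) (.of_forall fun x => by
      rw [Real.norm_eq_abs, Real.abs_exp, Real.exp_le_exp]
      exact (le_abs_self _).trans (hM x))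
  have h2 : Integrable (fun x => g x * Real.exp (g x)) (gibbs Φ) :=
    h1.bdd_mul (c := M) (by fun_prop) (.of_forall hM)
  set m := ∫ x, Real.exp (g x) ∂(gibbs Φ) with hm
  have hm0 : 0 < m := integral_exp_pos h1
  have e1 : ∀ x, Real.exp (g x - Real.log m) = m⁻¹ * Real.exp (g x) := fun x => by
    rw [Real.exp_sub, Real.exp_log hm0, div_eq_inv_mul]
  have e2 : ∀ x, gradient (fun y => g y - Real.log m) x = gradient g x := fun x => by
    simp [gradient, fderiv_sub_const]
  have h := hΦ.integral_mul_exp_le_of_bounded (g := fun x => g x - Real.log m)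
    (L := L) (M := M + |Real.log m|) (hg.sub contDiff_const) (fun x => (e2 x).symm ▸ hL x)
    (fun x => (abs_sub _ _).trans (by linarith [hM x])) hδ hδ' hC hkey
    (by simp only [e1]; rw [integral_const_mul, ← hm, inv_mul_cancel₀ hm0.ne'])
  simp only [e1, e2] at h
  have e3 : ∀ x, (g x - Real.log m) * (m⁻¹ * Real.exp (g x)) =
      m⁻¹ * (g x * Real.exp (g x) - Real.log m * Real.exp (g x)) := fun x => by ring
  have e4 : ∀ x, (δ * Φ x + 2 * legendre Φ ((2 * C) • gradient g x)) * (m⁻¹ * Real.exp (g x)) =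
      m⁻¹ * ((δ * Φ x + 2 * legendre Φ ((2 * C) • gradient g x)) * Real.exp (g x)) :=
    fun x => by ring
  simp only [e3, e4] at h
  rw [integral_const_mul, integral_const_mul, integral_sub h2 (h1.const_mul _),
    integral_const_mul, ← hm] at h
  have h' := le_of_mul_le_mul_left h (inv_pos.2 hm0)
  linarith

/-- The functions `χ_N g` have compact support, hence bounded gradient `χ_N ∇g + g ∇χ_N`. Midpoint
convexity of `Φ*` separates the two terms: the first is dominated through `hint`, which explains `4
* C`, and the second stays in a fixed ball. -/
theorem entropy_le_of_bounded_of_integrable {g : EuclideanSpace ℝ (Fin n) → ℝ}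
    (hg : ContDiff ℝ 1 g)
    {M : ℝ} (hM : ∀ x, |g x| ≤ M) {δ C : ℝ} (hδ : 0 < δ) (hδ' : δ ≤ 1 / 4) (hC : 0 < C)
    (hkey : ∀ z p, inner ℝ p z + Φ z - inner ℝ (gradient Φ z) z + legendre Φ (gradient Φ z - p)
      ≤ δ * Φ z + 2 * legendre Φ (C • p))
    (hint : Integrable (fun x => legendre Φ ((4 * C) • gradient g x)) (gibbs Φ)) :
    ∫ x, g x * Real.exp (g x) ∂(gibbs Φ)
        - (∫ x, Real.exp (g x) ∂(gibbs Φ)) * Real.log (∫ x, Real.exp (g x) ∂(gibbs Φ)) ≤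
      ∫ x, (δ * Φ x + 2 * legendre Φ ((2 * C) • gradient g x)) * Real.exp (g x) ∂(gibbs Φ) := by
  have := hΦ.isProbabilityMeasure_gibbs
  have hΦc := hΦ.continuous
  have hlc := hΦ.continuous_legendre
  have hgc := hg.continuous
  have hM0 : 0 ≤ M := (abs_nonneg _).trans (hM 0)
  let f : ContDiffBump (0 : EuclideanSpace ℝ (Fin n)) := ⟨1, 2, one_pos, one_lt_two⟩
  have hf : ContDiff ℝ 1 f := f.contDiff
  obtain ⟨K, hK⟩ := f.hasCompactSupport.exists_norm_gradient_le hf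
  have hK0 : 0 ≤ K := (norm_nonneg _).trans (hK 0)
  let χ : ℕ → EuclideanSpace ℝ (Fin n) → ℝ := fun N x => f ((N + 1 : ℝ)⁻¹ • x)
  have hχ : ∀ N, ContDiff ℝ 1 (χ N) := fun N => hf.comp (contDiff_const_smul _)
  have hχ0 : ∀ N x, 0 ≤ χ N x := fun N x => f.nonneg
  have hχ1 : ∀ N x, χ N x ≤ 1 := fun N x => f.le_one
  have hχg : ∀ N x, ‖gradient (χ N) x‖ ≤ K := by
    intro N x
    have hd : HasFDerivAt (χ N) _ x := ((hf.differentiable (by simp) _).hasFDerivAt).comp x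
      ((ContinuousLinearMap.id ℝ (EuclideanSpace ℝ (Fin n))).hasFDerivAt.const_smul (N + 1 : ℝ)⁻¹)
    have h1 := hK ((N + 1 : ℝ)⁻¹ • x)
    simp only [gradient, LinearIsometryEquiv.norm_map] at h1 ⊢
    rw [hd.fderiv]
    refine (ContinuousLinearMap.opNorm_comp_le _ _).trans ?_
    have h2 : ‖(N + 1 : ℝ)⁻¹ • ContinuousLinearMap.id ℝ (EuclideanSpace ℝ (Fin n))‖ ≤ 1 := by
      rw [norm_smul, norm_inv, Real.norm_of_nonneg (by positivity)]
      refine mul_le_one₀ (inv_le_one_of_one_le₀ (by simp)) (norm_nonneg _)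
        ContinuousLinearMap.norm_id_le
    calc _ ≤ K * 1 := by gcongr
      _ = K := mul_one K
  have hχc : ∀ N, HasCompactSupport (χ N) := fun N =>
    f.hasCompactSupport.comp_smul (inv_ne_zero (by positivity))
  -- Equality near `x`, not only at `x`, so that gradients agree too.
  have hχe : ∀ x, ∀ᶠ N in atTop, χ N =ᶠ[𝓝 x] 1 := by
    intro x
    obtain ⟨N₀, hN₀⟩ := exists_nat_gt ‖x‖
    filter_upwards [eventually_ge_atTop N₀] with N hN
    have : ∀ᶠ y in 𝓝 x, ‖y‖ < N₀ := continuous_norm.continuousAt.eventually (gt_mem_nhds hN₀)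
    filter_upwards [this] with y hy
    refine f.one_of_mem_closedBall ?_
    have h3 : (N₀ : ℝ) ≤ N := by exact_mod_cast hN
    rw [mem_closedBall_zero_iff, norm_smul, norm_inv, Real.norm_of_nonneg (by positivity)]
    change (N + 1 : ℝ)⁻¹ * ‖y‖ ≤ 1
    rw [inv_mul_le_iff₀ (by positivity)]
    linarith
  let G : ℕ → EuclideanSpace ℝ (Fin n) → ℝ := fun N x => χ N x * g x
  have hG : ∀ N, ContDiff ℝ 1 (G N) := fun N => (hχ N).mul hg
  have hGM : ∀ N x, |G N x| ≤ M := fun N x => by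
    simp only [G]
    rw [abs_mul, abs_of_nonneg (hχ0 N x)]
    exact (mul_le_of_le_one_left (abs_nonneg _) (hχ1 N x)).trans (hM x)
  have hGe : ∀ x, ∀ᶠ N in atTop, G N =ᶠ[𝓝 x] g := fun x => (hχe x).mono fun N hN =>
    hN.mono fun y hy => by simp [G, hy]
  have hGexp : ∀ N x, Real.exp (G N x) ≤ Real.exp M := fun N x =>
    Real.exp_le_exp.2 ((le_abs_self _).trans (hGM N x))
  have main : ∀ N, ∫ x, G N x * Real.exp (G N x) ∂(gibbs Φ)
        - (∫ x, Real.exp (G N x) ∂(gibbs Φ)) * Real.log (∫ x, Real.exp (G N x) ∂(gibbs Φ)) ≤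
      ∫ x, (δ * Φ x + 2 * legendre Φ ((2 * C) • gradient (G N) x)) * Real.exp (G N x)
        ∂(gibbs Φ) := by
    intro N
    obtain ⟨L, hL⟩ := ((hχc N).mul_right (f' := g)).exists_norm_gradient_le (hG N)
    exact hΦ.entropy_le_of_bounded (hG N) hL (hGM N) hδ hδ' hC hkey
  have lim1 : Tendsto (fun N => ∫ x, Real.exp (G N x) ∂(gibbs Φ)) atTop
      (𝓝 (∫ x, Real.exp (g x) ∂(gibbs Φ))) := by
    refine tendsto_integral_of_dominated_convergence (fun _ => Real.exp M) (fun N => ?_)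
      (integrable_const _) (fun N => .of_forall fun x => ?_) (.of_forall fun x => ?_)
    · have := (hG N).continuous
      exact (by fun_prop : Continuous _).aestronglyMeasurable
    · rw [Real.norm_eq_abs, Real.abs_exp]
      exact hGexp N x
    · exact tendsto_const_nhds.congr' ((hGe x).mono fun N hN => by beta_reduce; rw [hN.self_of_nhds])
  have lim2 : Tendsto (fun N => ∫ x, G N x * Real.exp (G N x) ∂(gibbs Φ)) atTop
      (𝓝 (∫ x, g x * Real.exp (g x) ∂(gibbs Φ))) := by
    refine tendsto_integral_of_dominated_convergence (fun _ => M * Real.exp M) (fun N => ?_)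
      (integrable_const _) (fun N => .of_forall fun x => ?_) (.of_forall fun x => ?_)
    · have := (hG N).continuous
      exact (by fun_prop : Continuous _).aestronglyMeasurable
    · rw [norm_mul, Real.norm_eq_abs, Real.norm_eq_abs, Real.abs_exp]
      exact mul_le_mul (hGM N x) (hGexp N x) (Real.exp_pos _).le hM0
    · exact tendsto_const_nhds.congr' ((hGe x).mono fun N hN => by beta_reduce; rw [hN.self_of_nhds])
  obtain ⟨D, hD⟩ := (isCompact_closedBall (0 : EuclideanSpace ℝ (Fin n))
    (4 * C * (M * K))).exists_bound_of_continuousOn hlc.continuousOn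
  have hdom : Integrable (fun x => (δ * Φ x + (legendre Φ ((4 * C) • gradient g x) + D))
      * Real.exp M) (gibbs Φ) :=
    ((hΦ.integrable_gibbs.const_mul δ).add (hint.add (integrable_const D))).mul_const _
  have hlG : ∀ N x, 2 * legendre Φ ((2 * C) • gradient (G N) x) ≤
      legendre Φ ((4 * C) • gradient g x) + D := by
    intro N x
    have hgr : gradient (G N) x = χ N x • gradient g x + g x • gradient (χ N) x :=
      gradient_mul ((hχ N).differentiable (by simp) x) (hg.differentiable (by simp) x)
    have h1 := hΦ.convexOn_legendre.2 (Set.mem_univ (χ N x • (4 * C) • gradient g x))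
      (Set.mem_univ ((4 * C) • g x • gradient (χ N) x))
      (show (0 : ℝ) ≤ 1 / 2 by norm_num) (show (0 : ℝ) ≤ 1 / 2 by norm_num) (by norm_num)
    have e : (1 / 2 : ℝ) • χ N x • (4 * C) • gradient g x
        + (1 / 2 : ℝ) • (4 * C) • g x • gradient (χ N) x = (2 * C) • gradient (G N) x := by
      rw [hgr]
      module
    rw [e, smul_eq_mul, smul_eq_mul] at h1
    have h2 := (hΦ.legendre_smul_le (hχ0 N x) (hχ1 N x) ((4 * C) • gradient g x)).trans
      (mul_le_of_le_one_left (hΦ.legendre_nonneg _) (hχ1 N x))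
    have h3 : legendre Φ ((4 * C) • g x • gradient (χ N) x) ≤ D := by
      refine (le_abs_self _).trans (hD _ ?_)
      rw [mem_closedBall_zero_iff, norm_smul, norm_smul, Real.norm_of_nonneg (by positivity)]
      gcongr
      · exact hM x
      · exact hχg N x
    linarith
  have lim3 : Tendsto (fun N => ∫ x, (δ * Φ x + 2 * legendre Φ ((2 * C) • gradient (G N) x))
      * Real.exp (G N x) ∂(gibbs Φ)) atTop
      (𝓝 (∫ x, (δ * Φ x + 2 * legendre Φ ((2 * C) • gradient g x)) * Real.exp (g x)
        ∂(gibbs Φ))) := by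
    refine tendsto_integral_of_dominated_convergence _ (fun N => ?_) hdom
      (fun N => .of_forall fun x => ?_) (.of_forall fun x => ?_)
    · have := (hG N).continuous
      have := (hG N).continuous_gradient
      exact (by fun_prop : Continuous _).aestronglyMeasurable
    · have h1 := hΦ.legendre_nonneg ((2 * C) • gradient (G N) x)
      have h2 := mul_nonneg hδ.le (hΦ.nonneg x)
      rw [norm_mul, Real.norm_of_nonneg (by positivity), Real.norm_eq_abs, Real.abs_exp]
      exact mul_le_mul (by linarith [hlG N x]) (hGexp N x) (Real.exp_pos _).le
        (by linarith [hlG N x])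
    · exact tendsto_const_nhds.congr' ((hGe x).mono fun N hN => by
        beta_reduce
        rw [hN.self_of_nhds, hN.gradient_eq])
  refine le_of_tendsto_of_tendsto' (lim2.sub ?_) lim3 main
  exact (Real.continuous_mul_log.tendsto _).comp lim1

end IsPotential

/-! ### Removing boundedness by truncating the values of `g` -/

/-- A bounded smooth truncation of the identity of `ℝ`, whose exponential is
`(e^x + ε) / (1 + ε e^x)`. -/
def expTrunc (ε x : ℝ) : ℝ := Real.log (Real.exp x + ε) - Real.log (1 + ε * Real.exp x)

section expTrunc

variable {ε : ℝ} (h0 : 0 < ε)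
include h0

theorem exp_expTrunc (x : ℝ) :
    Real.exp (expTrunc ε x) = (Real.exp x + ε) / (1 + ε * Real.exp x) := by
  have := Real.exp_pos x
  rw [expTrunc, Real.exp_sub, Real.exp_log (by positivity), Real.exp_log (by positivity)]

theorem exp_expTrunc_le (x : ℝ) : Real.exp (expTrunc ε x) ≤ Real.exp x + ε := by
  have := Real.exp_pos x
  rw [exp_expTrunc h0]
  exact div_le_self (by positivity) (by nlinarith)

theorem hasDerivAt_expTrunc (x : ℝ) :
    HasDerivAt (expTrunc ε)
      ((1 - ε ^ 2) * Real.exp x / ((Real.exp x + ε) * (1 + ε * Real.exp x))) x := by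
  have hx := Real.exp_pos x
  have h1 : HasDerivAt (fun x => Real.log (Real.exp x + ε)) (Real.exp x / (Real.exp x + ε)) x :=
    ((Real.hasDerivAt_exp x).add_const ε).log (by positivity)
  have h2 : HasDerivAt (fun x => Real.log (1 + ε * Real.exp x))
      (ε * Real.exp x / (1 + ε * Real.exp x)) x :=
    (((Real.hasDerivAt_exp x).const_mul ε).const_add 1).log (by positivity)
  have h3 : HasDerivAt (expTrunc ε)
      (Real.exp x / (Real.exp x + ε) - ε * Real.exp x / (1 + ε * Real.exp x)) x := h1.sub h2
  convert h3 using 1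
  field_simp
  ring

theorem contDiff_expTrunc : ContDiff ℝ 1 (expTrunc ε) := by
  have : ∀ x, Real.exp x + ε ≠ 0 := fun x => by positivity
  have : ∀ x, 1 + ε * Real.exp x ≠ 0 := fun x => by positivity
  unfold expTrunc
  fun_prop (disch := assumption)

theorem deriv_expTrunc_nonneg (h1 : ε ≤ 1) (x : ℝ) : 0 ≤ deriv (expTrunc ε) x := by
  rw [(hasDerivAt_expTrunc h0 x).deriv]
  have := Real.exp_pos x
  have : 0 ≤ 1 - ε ^ 2 := by nlinarith
  positivity

theorem deriv_expTrunc_le_one (x : ℝ) : deriv (expTrunc ε) x ≤ 1 := by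
  rw [(hasDerivAt_expTrunc h0 x).deriv]
  have := Real.exp_pos x
  rw [div_le_one (by positivity)]
  nlinarith [mul_pos h0 this, mul_pos (mul_pos h0 this) this, mul_pos (mul_pos h0 h0) this]

/-- This is the reason for the choice of truncation `T`: although `e^T` may exceed `e^x`, the small
derivative compensates, so `Φ*(T' v) e^T ≤ T' Φ*(v) e^T ≤ Φ*(v) e^x`. -/
theorem deriv_expTrunc_mul_exp_le (x : ℝ) :
    deriv (expTrunc ε) x * Real.exp (expTrunc ε x) ≤ Real.exp x := by
  rw [(hasDerivAt_expTrunc h0 x).deriv, exp_expTrunc h0]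
  have hx := Real.exp_pos x
  have e : (1 - ε ^ 2) * Real.exp x / ((Real.exp x + ε) * (1 + ε * Real.exp x))
      * ((Real.exp x + ε) / (1 + ε * Real.exp x))
      = Real.exp x * ((1 - ε ^ 2) / (1 + ε * Real.exp x) ^ 2) := by
    field_simp
  rw [e]
  refine mul_le_of_le_one_right hx.le ?_
  rw [div_le_one (by positivity)]
  nlinarith [mul_pos h0 hx, sq_nonneg (ε * Real.exp x)]

theorem abs_expTrunc_le (h1 : ε ≤ 1) (x : ℝ) : |expTrunc ε x| ≤ -Real.log ε := by
  have hx := Real.exp_pos x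
  rw [abs_le, neg_neg, ← Real.log_inv]
  constructor
  · rw [Real.log_le_iff_le_exp h0, exp_expTrunc h0, le_div_iff₀ (by positivity)]
    nlinarith [mul_pos h0 hx]
  · rw [Real.le_log_iff_exp_le (by positivity), exp_expTrunc h0, div_le_iff₀ (by positivity)]
    have : ε⁻¹ * (1 + ε * Real.exp x) = ε⁻¹ + Real.exp x := by field_simp
    rw [this]
    linarith [(one_le_inv₀ h0).2 h1]

/-- For `x ≥ 0` the truncation lies between `0` and `x`; for `x ≤ 0` it is nonpositive, and `y e^y ≥
-1` always. -/
theorem abs_expTrunc_mul_exp_le (h1 : ε ≤ 1) (x : ℝ) :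
    |expTrunc ε x * Real.exp (expTrunc ε x)| ≤ 1 + |x * Real.exp x| := by
  have hx := Real.exp_pos x
  rcases le_total 0 x with h | h
  · have h2 : 1 ≤ Real.exp x := Real.one_le_exp h
    have h3 : 0 ≤ expTrunc ε x := by
      rw [← Real.one_le_exp_iff, exp_expTrunc h0, le_div_iff₀ (by positivity)]
      nlinarith [mul_nonneg (sub_nonneg.2 h1) (sub_nonneg.2 h2)]
    have h4 : expTrunc ε x ≤ x := by
      rw [← Real.exp_le_exp, exp_expTrunc h0, div_le_iff₀ (by positivity)]
      nlinarith [mul_le_mul h2 h2 zero_le_one hx.le]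
    rw [abs_of_nonneg (by positivity), abs_of_nonneg (by positivity)]
    have : expTrunc ε x * Real.exp (expTrunc ε x) ≤ x * Real.exp x := by gcongr
    linarith
  · have h2 : Real.exp x ≤ 1 := Real.exp_le_one_iff.2 h
    have h3 : expTrunc ε x ≤ 0 := by
      rw [← Real.exp_le_one_iff, exp_expTrunc h0, div_le_one (by positivity)]
      nlinarith [mul_nonneg (sub_nonneg.2 h1) (sub_nonneg.2 h2)]
    set y := expTrunc ε x
    have h4 := Real.add_one_le_exp (-y)
    have h5 : -y * Real.exp y ≤ 1 := by
      have := mul_le_mul_of_nonneg_right (show -y ≤ Real.exp (-y) by linarith) (Real.exp_pos y).le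
      rwa [← Real.exp_add, neg_add_cancel, Real.exp_zero] at this
    rw [abs_mul, Real.abs_exp, abs_of_nonpos h3]
    linarith [abs_nonneg (x * Real.exp x)]

end expTrunc

theorem tendsto_expTrunc (x : ℝ) {e : ℕ → ℝ} (he : Tendsto e atTop (𝓝 0)) :
    Tendsto (fun N => expTrunc (e N) x) atTop (𝓝 x) := by
  have hc : ContinuousAt (fun ε => expTrunc ε x) 0 := by
    unfold expTrunc
    refine ContinuousAt.sub (ContinuousAt.log (by fun_prop) ?_) (ContinuousAt.log (by fun_prop) ?_)
    · simp
    · simp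
  have := hc.tendsto.comp he
  simpa [expTrunc, Function.comp_def] using this

namespace IsPotential

variable {Φ : EuclideanSpace ℝ (Fin n) → ℝ} (hΦ : IsPotential Φ)
include hΦ

/-- The modified logarithmic Sobolev inequality, up to a small multiple of the potential. -/
theorem integral_mul_exp_le {g : EuclideanSpace ℝ (Fin n) → ℝ} (hg : ContDiff ℝ 1 g)
    {δ C : ℝ} (hδ : 0 < δ) (hδ' : δ ≤ 1 / 4) (hC : 0 < C)
    (hkey : ∀ z p, inner ℝ p z + Φ z - inner ℝ (gradient Φ z) z + legendre Φ (gradient Φ z - p)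
      ≤ δ * Φ z + 2 * legendre Φ (C • p))
    (h0 : Integrable (fun x => Real.exp (g x)) (gibbs Φ))
    (h1 : Integrable (fun x => g x * Real.exp (g x)) (gibbs Φ))
    (hg1 : ∫ x, Real.exp (g x) ∂(gibbs Φ) = 1)
    (hΦg : Integrable (fun x => Φ x * Real.exp (g x)) (gibbs Φ))
    (hint : Integrable (fun x => legendre Φ ((4 * C) • gradient g x) * Real.exp (g x)) (gibbs Φ)) :
    ∫ x, g x * Real.exp (g x) ∂(gibbs Φ) ≤ δ * ∫ x, Φ x * Real.exp (g x) ∂(gibbs Φ)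
      + 2 * ∫ x, legendre Φ ((4 * C) • gradient g x) * Real.exp (g x) ∂(gibbs Φ) := by
  have := hΦ.isProbabilityMeasure_gibbs
  have hΦc := hΦ.continuous
  have hlc := hΦ.continuous_legendre
  have hgc := hg.continuous
  let e : ℕ → ℝ := fun N => 1 / ((N : ℝ) + 1)
  have he : Tendsto e atTop (𝓝 0) := tendsto_one_div_add_atTop_nhds_zero_nat
  have he0 : ∀ N, 0 < e N := fun N => by positivity
  have he1 : ∀ N, e N ≤ 1 := fun N => by
    simp only [e]
    rw [div_le_one (by positivity)]
    simp
  let G : ℕ → EuclideanSpace ℝ (Fin n) → ℝ := fun N x => expTrunc (e N) (g x)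
  have hG : ∀ N, ContDiff ℝ 1 (G N) := fun N => (contDiff_expTrunc (he0 N)).comp hg
  have hGg : ∀ N x, gradient (G N) x = deriv (expTrunc (e N)) (g x) • gradient g x := fun N x =>
    gradient_comp_real (hasDerivAt_expTrunc (he0 N) (g x)).differentiableAt.hasDerivAt
      (hg.differentiable (by simp) x)
  have hlG : ∀ (N : ℕ) (c : ℝ) x, legendre Φ (c • gradient (G N) x) * Real.exp (G N x) ≤
      legendre Φ (c • gradient g x) * Real.exp (g x) := by
    intro N c x
    rw [hGg, smul_comm]
    have h2 := hΦ.legendre_smul_le (deriv_expTrunc_nonneg (he0 N) (he1 N) (g x))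
      (deriv_expTrunc_le_one (he0 N) (g x)) (c • gradient g x)
    calc _ ≤ deriv (expTrunc (e N)) (g x) * legendre Φ (c • gradient g x) * Real.exp (G N x) := by
          gcongr
      _ = legendre Φ (c • gradient g x) *
          (deriv (expTrunc (e N)) (g x) * Real.exp (expTrunc (e N) (g x))) := by
          simp only [G]; ring
      _ ≤ _ := mul_le_mul_of_nonneg_left (deriv_expTrunc_mul_exp_le (he0 N) (g x))
          (hΦ.legendre_nonneg _)
  have main : ∀ N, ∫ x, G N x * Real.exp (G N x) ∂(gibbs Φ)
        - (∫ x, Real.exp (G N x) ∂(gibbs Φ)) * Real.log (∫ x, Real.exp (G N x) ∂(gibbs Φ)) ≤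
      δ * ((∫ x, Φ x * Real.exp (g x) ∂(gibbs Φ)) + e N * ∫ x, Φ x ∂(gibbs Φ))
      + 2 * ∫ x, legendre Φ ((4 * C) • gradient g x) * Real.exp (g x) ∂(gibbs Φ) := by
    intro N
    have hGc := (hG N).continuous
    have hGgc := (hG N).continuous_gradient
    have hGb : ∀ x, |G N x| ≤ -Real.log (e N) := fun x => abs_expTrunc_le (he0 N) (he1 N) (g x)
    -- The truncation satisfies `e^G ≥ ε`, so the weight `e^G` can be removed at the cost of `ε⁻¹`.
    have hi : Integrable (fun x => legendre Φ ((4 * C) • gradient (G N) x)) (gibbs Φ) := by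
      refine (hint.const_mul (e N)⁻¹).mono' (by fun_prop : Continuous _).aestronglyMeasurable
        (.of_forall fun x => ?_)
      rw [Real.norm_of_nonneg (hΦ.legendre_nonneg _), ← div_eq_inv_mul, le_div_iff₀ (he0 N)]
      refine le_trans ?_ (hlG N (4 * C) x)
      refine mul_le_mul_of_nonneg_left ?_ (hΦ.legendre_nonneg _)
      rw [← Real.log_le_iff_le_exp (he0 N)]
      linarith [(abs_le.1 (hGb x)).1]
    refine (hΦ.entropy_le_of_bounded_of_integrable (hG N) hGb hδ hδ' hC hkey hi).trans ?_
    have hr1 := (hΦg.add (hΦ.integrable_gibbs.const_mul (e N))).const_mul δ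
    have hr2 := hint.const_mul 2
    calc _ ≤ ∫ x, (δ * (Φ x * Real.exp (g x) + e N * Φ x)
          + 2 * (legendre Φ ((4 * C) • gradient g x) * Real.exp (g x))) ∂(gibbs Φ) := by
          refine integral_mono_of_nonneg (.of_forall fun x => ?_) (hr1.add hr2)
            (.of_forall fun x => ?_)
          · exact mul_nonneg (add_nonneg (mul_nonneg hδ.le (hΦ.nonneg x))
              (mul_nonneg zero_le_two (hΦ.legendre_nonneg _))) (Real.exp_pos _).le
          · have h2 := hlG N (2 * C) x
            have h3 : legendre Φ ((2 * C) • gradient g x) * Real.exp (g x) ≤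
                legendre Φ ((4 * C) • gradient g x) * Real.exp (g x) :=
              mul_le_mul_of_nonneg_right (hΦ.legendre_smul_mono (by positivity) (by linarith) _)
                (Real.exp_pos _).le
            have h4 := mul_le_mul_of_nonneg_left (exp_expTrunc_le (he0 N) (g x))
              (mul_nonneg hδ.le (hΦ.nonneg x))
            simp only [G] at h2 ⊢
            linarith
      _ = _ := by
          have e1 := integral_add hr1 hr2
          have e2 := integral_add hΦg (hΦ.integrable_gibbs.const_mul (e N))
          simp only [Pi.add_apply, integral_const_mul] at e1 e2
          rw [e1, e2]
  have lim1 : Tendsto (fun N => ∫ x, Real.exp (G N x) ∂(gibbs Φ)) atTop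
      (𝓝 (∫ x, Real.exp (g x) ∂(gibbs Φ))) := by
    refine tendsto_integral_of_dominated_convergence _ (fun N => ?_)
      (h0.add (integrable_const 1)) (fun N => .of_forall fun x => ?_) (.of_forall fun x => ?_)
    · have := (hG N).continuous
      exact (by fun_prop : Continuous _).aestronglyMeasurable
    · rw [Real.norm_eq_abs, Real.abs_exp]
      exact (exp_expTrunc_le (he0 N) (g x)).trans (by simpa using he1 N)
    · exact (Real.continuous_exp.tendsto _).comp (tendsto_expTrunc (g x) he)
  have lim2 : Tendsto (fun N => ∫ x, G N x * Real.exp (G N x) ∂(gibbs Φ)) atTop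
      (𝓝 (∫ x, g x * Real.exp (g x) ∂(gibbs Φ))) := by
    refine tendsto_integral_of_dominated_convergence _ (fun N => ?_)
      ((integrable_const 1).add h1.abs) (fun N => .of_forall fun x => ?_) (.of_forall fun x => ?_)
    · have := (hG N).continuous
      exact (by fun_prop : Continuous _).aestronglyMeasurable
    · exact abs_expTrunc_mul_exp_le (he0 N) (he1 N) (g x)
    · have h2 := tendsto_expTrunc (g x) he
      exact h2.mul ((Real.continuous_exp.tendsto _).comp h2)
  have lim3 : Tendsto (fun N =>
      δ * ((∫ x, Φ x * Real.exp (g x) ∂(gibbs Φ)) + e N * ∫ x, Φ x ∂(gibbs Φ))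
      + 2 * ∫ x, legendre Φ ((4 * C) • gradient g x) * Real.exp (g x) ∂(gibbs Φ)) atTop
      (𝓝 (δ * ((∫ x, Φ x * Real.exp (g x) ∂(gibbs Φ)) + 0 * ∫ x, Φ x ∂(gibbs Φ))
      + 2 * ∫ x, legendre Φ ((4 * C) • gradient g x) * Real.exp (g x) ∂(gibbs Φ))) :=
    (((he.mul_const _).const_add _).const_mul _).add_const _
  have h2 := le_of_tendsto_of_tendsto' (lim2.sub ((Real.continuous_mul_log.tendsto _).comp lim1))
    lim3 main
  simpa [hg1] using h2

end IsPotential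

/-! ### Absorbing the potential term -/

/-- Young's inequality for the entropy. -/
theorem mul_exp_le_entropy (a b : ℝ) :
    a * Real.exp b ≤ 2 * (b * Real.exp b - Real.exp b + Real.exp (a / 2)) := by
  -- The tangent line of `exp` at `b`, evaluated at `a / 2`.
  have h := Real.add_one_le_exp (a / 2 - b)
  have h2 := mul_le_mul_of_nonneg_right h (Real.exp_pos b).le
  rw [← Real.exp_add, sub_add_cancel] at h2
  linarith

end

theorem mainTheorem7 (n : ℕ) (Φ : EuclideanSpace ℝ (Fin n) → ℝ)
    (hΦ_smooth : ContDiff ℝ 1 Φ)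
    (hΦ_convex : StrictConvexOn ℝ Set.univ Φ)
    (hΦ_even : ∀ x, Φ (-x) = Φ x)
    (hΦ_superlinear :
      Tendsto (fun x => Φ x / ‖x‖) (cocompact (EuclideanSpace ℝ (Fin n))) atTop)
    (hΦ_nonneg : ∀ x, 0 ≤ Φ x)
    (hΦ_zero : Φ 0 = 0)
    (hΦ_ratio : Tendsto (legendreRatio Φ) (𝓝[Set.Icc 0 1] 0) (𝓝 1))
    (A : ℝ) (hA : 0 < A)
    (hΦ_growth : ∀ x, inner ℝ x (gradient Φ x) ≤ (A + 1) * Φ x) :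
    ∃ C₁ C₂ : ℝ, 0 ≤ C₁ ∧ 0 ≤ C₂ ∧
      ∀ g : EuclideanSpace ℝ (Fin n) → ℝ, ContDiff ℝ 1 g →
        Integrable (fun x => Real.exp (g x)) (gibbs Φ) →
        Integrable (fun x => g x * Real.exp (g x)) (gibbs Φ) →
        ∫ x, Real.exp (g x) ∂(gibbs Φ) = 1 →
        1 ≤ ent (gibbs Φ) (fun x => Real.exp (g x)) →
        ENNReal.ofReal (ent (gibbs Φ) (fun x => Real.exp (g x))) ≤
          ENNReal.ofReal C₁ *
            ∫⁻ x, ENNReal.ofReal (legendre Φ (C₂ • gradient g x) * Real.exp (g x)) ∂(gibbs Φ) := by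
  have hΦ : IsPotential Φ :=
    ⟨hΦ_smooth, hΦ_convex.convexOn, hΦ_even, hΦ_superlinear, hΦ_nonneg, hΦ_zero⟩
  have hprob := hΦ.isProbabilityMeasure_gibbs
  set c := ∫ x, Real.exp (Φ x / 2) ∂(gibbs Φ) with hc
  have hc0 : 0 ≤ c := integral_nonneg fun x => (Real.exp_pos _).le
  -- This `δ` makes the potential term at most `E / 2`, and is at most `1 / 4` because `c ≥ 0`.
  obtain ⟨C, hC, hkey⟩ := hΦ.exists_le_mul_add_legendre hΦ_ratio hA hΦ_growth
    (δ := 1 / (4 * (1 + c))) (by positivity)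
  refine ⟨4, 4 * C, by norm_num, by positivity, fun g hg h0 h1 hg1 hent => ?_⟩
  have hE : ent (gibbs Φ) (fun x => Real.exp (g x)) = ∫ x, g x * Real.exp (g x) ∂(gibbs Φ) := by
    simp only [ent, hg1, div_one, Real.log_exp]
    exact integral_congr_ae (.of_forall fun x => mul_comm _ _)
  rw [hE] at hent ⊢
  have hlc := hΦ.continuous_legendre
  have hgc := hg.continuous
  have hΦc := hΦ.continuous
  have hggc := hg.continuous_gradient
  have hnn : ∀ x, 0 ≤ legendre Φ ((4 * C) • gradient g x) * Real.exp (g x) := fun x =>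
    mul_nonneg (hΦ.legendre_nonneg _) (Real.exp_pos _).le
  by_cases htop : ∫⁻ x, ENNReal.ofReal (legendre Φ ((4 * C) • gradient g x) * Real.exp (g x))
      ∂(gibbs Φ) = ⊤
  · rw [htop, ENNReal.mul_top (by simp)]
    exact le_top
  have hint : Integrable (fun x => legendre Φ ((4 * C) • gradient g x) * Real.exp (g x))
      (gibbs Φ) := by
    refine ⟨(by fun_prop : Continuous _).aestronglyMeasurable, ?_⟩
    rw [hasFiniteIntegral_iff_ofReal (.of_forall hnn)]
    exact lt_top_iff_ne_top.2 htop
  rw [← ofReal_integral_eq_lintegral_ofReal hint (.of_forall hnn),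
    ← ENNReal.ofReal_mul (by norm_num)]
  refine ENNReal.ofReal_le_ofReal ?_
  have hdom := ((h1.sub h0).add hΦ.integrable_exp_half_gibbs).const_mul 2
  have hΦg : Integrable (fun x => Φ x * Real.exp (g x)) (gibbs Φ) := by
    refine hdom.mono' (by fun_prop : Continuous _).aestronglyMeasurable (.of_forall fun x => ?_)
    rw [Real.norm_of_nonneg (mul_nonneg (hΦ.nonneg x) (Real.exp_pos _).le)]
    exact mul_exp_le_entropy (Φ x) (g x)
  set E := ∫ x, g x * Real.exp (g x) ∂(gibbs Φ) with hEdef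
  -- Young's inequality yields `2 * (E - 1 + c)`; `E ≥ 1` makes this at most a multiple of `E`.
  have hΦE : ∫ x, Φ x * Real.exp (g x) ∂(gibbs Φ) ≤ 2 * ((1 + c) * E) := by
    have h2 := integral_mono hΦg hdom fun x => mul_exp_le_entropy (Φ x) (g x)
    have h3 := integral_add (h1.sub h0) hΦ.integrable_exp_half_gibbs
    have h4 := integral_sub h1 h0
    simp only [Pi.add_apply, Pi.sub_apply, integral_const_mul] at h2 h3 h4
    rw [h3, h4, hg1, ← hc, ← hEdef] at h2
    nlinarith [mul_nonneg hc0 (sub_nonneg.2 hent)]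
  have hfin := hΦ.integral_mul_exp_le hg (by positivity)
    (by rw [div_le_div_iff₀ (by positivity) (by norm_num)]; linarith) hC hkey h0 h1 hg1 hΦg hint
  rw [← hEdef] at hfin
  have h5 : 1 / (4 * (1 + c)) * ∫ x, Φ x * Real.exp (g x) ∂(gibbs Φ) ≤ E / 2 := by
    calc _ ≤ 1 / (4 * (1 + c)) * (2 * ((1 + c) * E)) := by gcongr
      _ = E / 2 := by field_simp; ring
  linarith
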